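/- Let $s,n\ge 0$ be integers and let $N$ be a smooth ($C^\infty$, Hausdorff, boundaryless) manifold of dimension $n$. Let $\mathbf X_1=(X_{1,1},\dots,X_{1,s})$ and $\mathbf X_2=(X_{2,1},\dots,X_{2,s})$ be smooth $t$-dependent polyvector fields on $N$, i.e. each $X_{a,\pi}:\mathbb R^s\times N\to TN$ is smooth and $X_{a,\pi}(t,\cdot)$ is a vector field on $N$ for every $t\in\mathbb R^s$. The polyvector field $\mathbf X_a$ represents the system of first-order PDEs $$\frac{\partial x}{\partial t_\pi}=X_{a,\pi}(t,x),\qquad \pi=1,\dots,s .$$ Assume that both systems are integrable, i.e. the vector fields $\bar X_a^{[\pi]}=\partial_{t_\pi}+X_{a,\pi}$ on $\mathbb R^s\times N$ satisfy $[\bar X_a^{[\pi]},\bar X_a^{[\nu]}]=0$ for all $\pi,\nu=1,\dots,s$ and $a=1,2$. For open sets $\Omega_1,\Omega_2\subseteq\mathbb R^s\times N$, a bundle isomorphism $\phi:\Omega_1\to\Omega_2$ is a $C^\infty$ diffeomorphism of the form $\phi(t,x)=(t,y(t,x))$; the systems are bundle $\phi$-related if $\phi$ maps the first one onto the second one, i.e.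 $d\phi_p\big(\bar X_1^{[\pi]}(p)\big)=\bar X_2^{[\pi]}(\phi(p))$ for all $p\in\Omega_1$ and $\pi=1,\dots,s$. 1. (Global form.) If for each $a=1,2$ and all $t_0\in\mathbb R^s$, $x_0\in N$ the $a$-th system has a solution $\gamma:\mathbb R^s\to N$, defined on all of $\mathbb R^s$, with $\gamma(t_0)=x_0$, then the two systems are bundle $\phi$-related for some bundle isomorphism $\phi:\mathbb R^s\times N\to\mathbb R^s\times N$. 2. (Local form.) Without this assumption on global solutions, for every $t_0\in\mathbb R^s$ there are open sets $\Omega_1,\Omega_2\subseteq\mathbb R^s\times N$, both containing $\{t_0\}\times N$, such that the two systems are bundle $\phi$-related for some bundle isomorphism $\phi:\Omega_1\to\Omega_2$. -/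

import Mathlib

open Set
open scoped Manifold ContDiff

/-- A smooth `t`-dependent polyvector field on an `n`-dimensional manifold `N`, viewed as a vector
`(X_1, …, X_s)` of smooth `t`-dependent vector fields `X_π : ℝ^s × N → TN`.
It stands for the system `∂x^i/∂t_π = X^i_π(t, x)`. -/
structure PolyvectorField (s n : ℕ) (N : Type*) [TopologicalSpace N]
    [ChartedSpace (EuclideanSpace ℝ (Fin n)) N] [IsManifold (𝓡 n) ∞ N] where
  /-- The component `X_π`, evaluated at `(t, x)`. -/
  comp : Fin s → EuclideanSpace ℝ (Fin s) → (x : N) → TangentSpace (𝓡 n) x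
  smooth_comp : ∀ π : Fin s,
    ContMDiff ((𝓡 s).prod (𝓡 n)) (𝓡 n).tangent ∞
      (fun p : EuclideanSpace ℝ (Fin s) × N =>
        (⟨p.2, comp π p.1 p.2⟩ : TangentBundle (𝓡 n) N))

namespace PolyvectorField

variable {s n : ℕ} {N : Type*} [TopologicalSpace N]
  [ChartedSpace (EuclideanSpace ℝ (Fin n)) N] [IsManifold (𝓡 n) ∞ N]

/-- The `π`-th component `∂_{t_π} + X_π` of the autonomisation of `X`,
a vector field on `ℝ^s × N`. -/
noncomputable def autonomised (X : PolyvectorField s n N) (π : Fin s)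
    (p : EuclideanSpace ℝ (Fin s) × N) : TangentSpace ((𝓡 s).prod (𝓡 n)) p :=
  ((EuclideanSpace.single π (1 : ℝ) : EuclideanSpace ℝ (Fin s)), X.comp π p.1 p.2)

/-- The zero curvature condition: the vector fields `∂_{t_π} + X_π` commute. -/
def Integrable (X : PolyvectorField s n N) : Prop :=
  ∀ (π ν : Fin s) (p : EuclideanSpace ℝ (Fin s) × N),
    VectorField.mlieBracket ((𝓡 s).prod (𝓡 n)) (X.autonomised π) (X.autonomised ν) p = 0

/-- `γ : ℝ^s → N` is a (globally defined) particular solution of the system given by `X`. -/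
def IsSolution (X : PolyvectorField s n N) (γ : EuclideanSpace ℝ (Fin s) → N) : Prop :=
  MDifferentiable (𝓡 s) (𝓡 n) γ ∧
    ∀ (π : Fin s) (t : EuclideanSpace ℝ (Fin s)),
      mfderiv (𝓡 s) (𝓡 n) γ t (EuclideanSpace.single π (1 : ℝ) : EuclideanSpace ℝ (Fin s))
        = X.comp π t (γ t)

/-- Every initial value problem has a solution defined on the whole of `ℝ^s`. -/
def HasGlobalSolutions (X : PolyvectorField s n N) : Prop :=
  ∀ (t₀ : EuclideanSpace ℝ (Fin s)) (x₀ : N), ∃ γ : EuclideanSpace ℝ (Fin s) → N,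
    X.IsSolution γ ∧ γ t₀ = x₀

/-- `X₁` and `X₂` are bundle `φ`-related: `φ`, a homeomorphism from the open set `φ.source` onto
the open set `φ.target` of `ℝ^s × N`, is a bundle isomorphism `(t, x) ↦ (t, y(t, x))` (a fibre
preserving diffeomorphism), and it maps the system `X₁` onto the system `X₂`, that is, its
differential maps each `∂_{t_π} + (X₁)_π` to `∂_{t_π} + (X₂)_π`. -/
structure BundleRelated (X₁ X₂ : PolyvectorField s n N)
    (φ : OpenPartialHomeomorph (EuclideanSpace ℝ (Fin s) × N) (EuclideanSpace ℝ (Fin s) × N)) :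
    Prop where
  smooth : ContMDiffOn ((𝓡 s).prod (𝓡 n)) ((𝓡 s).prod (𝓡 n)) ∞ φ φ.source
  smooth_symm : ContMDiffOn ((𝓡 s).prod (𝓡 n)) ((𝓡 s).prod (𝓡 n)) ∞ φ.symm φ.target
  fst_eq : ∀ p ∈ φ.source, (φ p).1 = p.1
  map_autonomised : ∀ p ∈ φ.source, ∀ π : Fin s,
    mfderiv ((𝓡 s).prod (𝓡 n)) ((𝓡 s).prod (𝓡 n)) φ p (X₁.autonomised π p)
      = X₂.autonomised π (φ p)

end PolyvectorField

/-! Both systems are equivalent to the trivial one, `∂x/∂t_π = 0`. If `F_a (t, t₀, x)` is the value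
at time `t` of the solution of system `a` through `(t₀, x)`, then `(t, x) ↦ (t, F_a (t, t₀, x))`
sends the horizontal leaves `x = const` to graphs of solutions. Hence `φ = (straightening of X₂) ∘
(straightening of X₁)⁻¹` carries solution graphs to solution graphs, and differentiating along a
graph gives the relation of the vector fields (`bundleRelated_straighten`).

The work lies in existence and smoothness of `F_a` near the diagonal `t = t₀`. In a chart the system
reads `Dy = A (t, y)`, and zero curvature is a symmetry of `DA` (`Integrable.chartField_symm`).
`exists_local_flow` solves the ODE along rays from `t₀` by the implicit function theorem in `C([0,
1], E)`; the symmetry makes the ray solutions solve the whole system (`variation_eq_of_integrable`).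
Solutions on convex sets are unique (`IsSolutionOn.eq_of_convex`), so the local flows define one
flow. All this gives the local form; with global solutions, a clopen argument in `t` makes the flow
smooth everywhere (`HasGlobalSolutions.flowRegular_eq`). -/

open Filter Topology

/-! ### Smoothness of superposition operators on spaces of continuous maps -/

section Superposition

variable {K : Type*} [TopologicalSpace K] [CompactSpace K]

/-- Pointwise application of a continuous family of continuous linear maps. -/
noncomputable def ContinuousMap.clmApplyL (X Y : Type*) [NormedAddCommGroup X] [NormedSpace ℝ X]
    [NormedAddCommGroup Y] [NormedSpace ℝ Y] :
    C(K, X →L[ℝ] Y) →L[ℝ] C(K, X) →L[ℝ] C(K, Y) :=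
  LinearMap.mkContinuous₂
    (LinearMap.mk₂ ℝ (fun (a : C(K, X →L[ℝ] Y)) (u : C(K, X)) =>
        (⟨fun r => a r (u r), a.continuous.clm_apply u.continuous⟩ : C(K, Y)))
      (fun a b u => by ext r; simp) (fun c a u => by ext r; simp)
      (fun a u v => by ext r; simp) (fun c a u => by ext r; simp)) 1
    (fun a u => by
      rw [one_mul, ContinuousMap.norm_le _ (by positivity)]
      intro r
      exact ((a r).le_opNorm (u r)).trans
        (mul_le_mul (a.norm_coe_le_norm r) (u.norm_coe_le_norm r) (norm_nonneg _) (norm_nonneg a)))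

@[simp]
theorem ContinuousMap.clmApplyL_apply {X Y : Type*} [NormedAddCommGroup X] [NormedSpace ℝ X]
    [NormedAddCommGroup Y] [NormedSpace ℝ Y] (a : C(K, X →L[ℝ] Y)) (u : C(K, X)) (r : K) :
    ContinuousMap.clmApplyL X Y a u r = a r (u r) := rfl

/-- The mean value inequality is applied at each `r`. It is uniform in `r` because `v ↦ f' ∘ v` is
continuous for the sup norm. -/
theorem ContinuousMap.hasFDerivAt_comp_left {X Y : Type*} [NormedAddCommGroup X] [NormedSpace ℝ X]
    [NormedAddCommGroup Y] [NormedSpace ℝ Y] (f : C(X, Y)) (f' : C(X, X →L[ℝ] Y))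
    (hf : ∀ x, HasFDerivAt f (f' x) x) (u : C(K, X)) :
    HasFDerivAt (fun u : C(K, X) => f.comp u) (ContinuousMap.clmApplyL X Y (f'.comp u)) u := by
  rw [hasFDerivAt_iff_isLittleO, Asymptotics.isLittleO_iff]
  intro ε hε
  have hc : Continuous fun v : C(K, X) => f'.comp v := f'.continuous_postcomp
  obtain ⟨δ, hδ, H⟩ := (Metric.continuous_iff (α := C(K, X)) (β := C(K, X →L[ℝ] Y))).1 hc u ε hε
  filter_upwards [Metric.ball_mem_nhds u hδ] with v hv
  rw [ContinuousMap.norm_le _ (by positivity)]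
  intro r
  have key : ∀ y ∈ Metric.ball (u r) δ, ‖f' y - f' (u r)‖ ≤ ε := by
    intro y hy
    -- Translating `u` by a constant function reaches any `y` near `u r`, so the sup-norm modulus
    -- also bounds `f'` on the whole ball.
    have h1 := H (u + ContinuousMap.const K (y - u r)) (by
      rw [dist_eq_norm, add_sub_cancel_left]
      refine lt_of_le_of_lt ((ContinuousMap.norm_le _ (norm_nonneg (y - u r))).2 fun _ => le_rfl) ?_
      simpa [dist_eq_norm] using hy)
    have h2 := (ContinuousMap.dist_apply_le_dist (f := f'.comp (u + ContinuousMap.const K (y - u r)))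
      (g := f'.comp u) r).trans h1.le
    simpa [dist_eq_norm] using h2
  have h3 := (convex_ball (u r) δ).norm_image_sub_le_of_norm_hasFDerivWithin_le' (f := f)
    (f' := fun y => f' y) (φ := f' (u r)) (C := ε)
    (fun y _ => (hf y).hasFDerivWithinAt) key (Metric.mem_ball_self hδ)
    (y := v r) (lt_of_le_of_lt (ContinuousMap.dist_apply_le_dist r) hv)
  refine h3.trans ?_
  gcongr
  exact (v - u).norm_coe_le_norm r

universe u

/-- Up to the bounded operator `clmApplyL`, the derivative is the superposition operator of `f'`, so
induction applies. The target changes from `Y` to `X →L[ℝ] Y`, whence the quantification over `Y`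
and the common universe. -/
theorem ContinuousMap.contDiff_nat_comp_left (n : ℕ) {X : Type u} [NormedAddCommGroup X]
    [NormedSpace ℝ X] : ∀ {Y : Type u} [NormedAddCommGroup Y] [NormedSpace ℝ Y] (f : C(X, Y)),
    ContDiff ℝ n f → ContDiff ℝ n (fun u : C(K, X) => f.comp u) := by
  induction n with
  | zero =>
    intro Y _ _ f _
    exact contDiff_zero.2 f.continuous_postcomp
  | succ n ih =>
    intro Y _ _ f hf
    have hf' : ContDiff ℝ n (fderiv ℝ f) := by
      exact hf.fderiv_right (by norm_cast)
    have hd := ContinuousMap.hasFDerivAt_comp_left (K := K) f ⟨fderiv ℝ f, hf'.continuous⟩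
      (fun x => (hf.differentiable (by norm_cast) x).hasFDerivAt)
    have : ContDiff ℝ ((n : WithTop ℕ∞) + 1) (fun u : C(K, X) => f.comp u) := by
      refine contDiff_succ_iff_hasFDerivAt.2 ⟨_, ?_, hd⟩
      exact (ContinuousMap.clmApplyL X Y).contDiff.comp (ih ⟨fderiv ℝ f, hf'.continuous⟩ hf')
    exact_mod_cast this

theorem ContinuousMap.contDiff_comp_left {X Y : Type u} [NormedAddCommGroup X]
    [NormedSpace ℝ X] [NormedAddCommGroup Y] [NormedSpace ℝ Y] (f : C(X, Y))
    (hf : ContDiff ℝ ∞ f) : ContDiff ℝ ∞ (fun u : C(K, X) => f.comp u) :=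
  contDiff_infty.2 fun n => ContinuousMap.contDiff_nat_comp_left n f (contDiff_infty.1 hf n)

end Superposition

/-! ### Implicit functions smooth on a neighbourhood -/

section Implicit

/-- Smoothness of order `∞` at one point does not by itself spread to a single neighbourhood.
Invertibility of the partial derivative is an open condition, so the theorem applies again at each
nearby `(p, φ p)`; local uniqueness identifies the new implicit function with `φ`. -/
theorem exists_eventually_contDiffAt_implicit {P U V : Type*}
    [NormedAddCommGroup P] [NormedSpace ℝ P] [CompleteSpace P]
    [NormedAddCommGroup U] [NormedSpace ℝ U] [CompleteSpace U]
    [NormedAddCommGroup V] [NormedSpace ℝ V] [CompleteSpace V]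
    {Ψ : P × U → V} (hΨ : ContDiff ℝ ∞ Ψ) {p₁ : P} {u₁ : U} (h₀ : Ψ (p₁, u₁) = 0)
    (hinv : (fderiv ℝ Ψ (p₁, u₁) ∘L .inr ℝ P U).IsInvertible) :
    ∃ φ : P → U, φ p₁ = u₁ ∧ ∀ᶠ p in 𝓝 p₁, ContDiffAt ℝ ∞ φ p ∧ Ψ (p, φ p) = 0 := by
  have hn : (∞ : WithTop ℕ∞) ≠ 0 := by simp
  have hat (q) : ContDiffAt ℝ ∞ Ψ q := hΨ.contDiffAt
  let φ := (hat (p₁, u₁)).implicitFunction hn hinv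
  have hφ₁ : φ p₁ = u₁ := (hat (p₁, u₁)).implicitFunction_apply_self hn hinv
  have hφc : ContDiffAt ℝ ∞ φ p₁ := (hat (p₁, u₁)).contDiffAt_implicitFunction hn hinv
  have hφ0 : ∀ᶠ p in 𝓝 p₁, Ψ (p, φ p) = 0 := by
    simpa [h₀] using (hat (p₁, u₁)).eventually_apply_implicitFunction hn hinv
  have hcont : ∀ᶠ p in 𝓝 p₁, ContinuousAt φ p :=
    ((hφc.of_le (m := 1) (by norm_cast)).eventually (by simp)).mono
      fun p hp => hp.continuousAt
  have hinv' : ∀ᶠ p in 𝓝 p₁, (fderiv ℝ Ψ (p, φ p) ∘L .inr ℝ P U).IsInvertible := by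
    obtain ⟨e, he⟩ := hinv
    have hc : ContinuousAt (fun p => fderiv ℝ Ψ (p, φ p) ∘L .inr ℝ P U) p₁ := by
      have h1 : Continuous (fderiv ℝ Ψ) := hΨ.continuous_fderiv (by simp)
      have h2 : ContinuousAt (fun p => fderiv ℝ Ψ (p, φ p)) p₁ :=
        h1.continuousAt.comp (continuousAt_id.prodMk hφc.continuousAt)
      exact h2.clm_comp continuousAt_const
    have := ContinuousLinearEquiv.nhds e
    rw [he, ← hφ₁] at this
    filter_upwards [hc this] with p hp
    exact hp
  refine ⟨φ, hφ₁, ?_⟩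
  filter_upwards [hφ0.eventually_nhds, hcont, hinv'] with p hp0 hpc hpi
  refine ⟨?_, hp0.self_of_nhds⟩
  refine ((hat (p, φ p)).contDiffAt_implicitFunction hn hpi).congr_of_eventuallyEq ?_
  have hT : Tendsto (fun p' => (p', φ p')) (𝓝 p) (𝓝 (p, φ p)) :=
    (continuousAt_id.prodMk hpc)
  filter_upwards [hT.eventually ((hat (p, φ p)).eventually_apply_eq_iff_implicitFunction hn hpi),
    hp0] with p' h1 h2
  exact (h1.1 (by rw [h2, hp0.self_of_nhds])).symm

end Implicit

/-! ### The primitive as a bounded operator -/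

section Integral

variable {E : Type*} [NormedAddCommGroup E] [NormedSpace ℝ E] [CompleteSpace E]

theorem ContinuousMap.continuous_IccExtend {E : Type*} [NormedAddCommGroup E]
    (u : C(unitInterval, E)) :
    Continuous (IccExtend zero_le_one u) := u.continuous.Icc_extend'

/-- The primitive vanishing at `0`, as a bounded operator on `C([0, 1], E)`. -/
noncomputable def ContinuousMap.primitiveL (E : Type*) [NormedAddCommGroup E] [NormedSpace ℝ E]
    [CompleteSpace E] : C(unitInterval, E) →L[ℝ] C(unitInterval, E) :=
  LinearMap.mkContinuous
    { toFun := fun u => ⟨fun r => ∫ ρ in (0 : ℝ)..r, IccExtend zero_le_one u ρ,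
        (intervalIntegral.continuous_primitive
          (fun a b => u.continuous_IccExtend.intervalIntegrable a b) 0).comp continuous_subtype_val⟩
      map_add' := fun u v => by
        ext r
        exact intervalIntegral.integral_add (u.continuous_IccExtend.intervalIntegrable _ _)
          (v.continuous_IccExtend.intervalIntegrable _ _)
      map_smul' := fun c u => by
        ext r
        exact intervalIntegral.integral_smul c _ } 1
    (fun u => by
      rw [one_mul, ContinuousMap.norm_le _ (norm_nonneg _)]
      intro r
      refine (intervalIntegral.norm_integral_le_of_norm_le_const (C := ‖u‖)
        fun ρ _ => u.norm_coe_le_norm _).trans ?_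
      rw [sub_zero, abs_of_nonneg r.2.1]
      exact mul_le_of_le_one_right (norm_nonneg _) r.2.2)

theorem ContinuousMap.hasDerivAt_primitive (u : C(unitInterval, E)) (r : ℝ) :
    HasDerivAt (fun r : ℝ => ∫ ρ in (0 : ℝ)..r, IccExtend zero_le_one u ρ)
      (IccExtend zero_le_one u r) r :=
  u.continuous_IccExtend.integral_hasStrictDerivAt 0 r |>.hasDerivAt

end Integral

/-! ### Smooth local flow of a total differential equation -/

section LocalFlow

/-- Along the ray `r ↦ t₀ + r τ`, the variation `Z` of a solution `u` of the total differential
equation `Dy = A (t, y)` in the direction `w` is `r • A w`, by integrability. -/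
theorem variation_eq_of_integrable {T E : Type*} [NormedAddCommGroup T] [NormedSpace ℝ T]
    [NormedAddCommGroup E] [NormedSpace ℝ E] [CompleteSpace E] {A : T × E → T →L[ℝ] E}
    (hA : ContDiff ℝ ∞ A) {t₀ τ w : T} {y : E} {u Z a b : C(unitInterval, E)}
    (ha : ∀ r : unitInterval, a r = A (t₀ + (r : ℝ) • τ, u r) τ)
    (hb : ∀ r : unitInterval, b r = fderiv ℝ A (t₀ + (r : ℝ) • τ, u r) ((r : ℝ) • w, Z r) τ
      + A (t₀ + (r : ℝ) • τ, u r) w)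
    (hu : ∀ r, u r = y + ContinuousMap.primitiveL E a r)
    (hZ : ∀ r, Z r = ContinuousMap.primitiveL E b r)
    (hsym : ∀ r : unitInterval, ∀ v w,
      fderiv ℝ A (t₀ + (r : ℝ) • τ, u r) (v, A (t₀ + (r : ℝ) • τ, u r) v) w =
      fderiv ℝ A (t₀ + (r : ℝ) • τ, u r) (w, A (t₀ + (r : ℝ) • τ, u r) w) v) :
    Z 1 = A (t₀ + τ, u 1) w := by
  set uR : ℝ → E := fun r => y + ∫ ρ in (0 : ℝ)..r, IccExtend zero_le_one a ρ with huR
  set ZR : ℝ → E := fun r => ∫ ρ in (0 : ℝ)..r, IccExtend zero_le_one b ρ with hZR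
  have huR' (r : unitInterval) : uR r = u r := (hu r).symm
  have hZR' (r : unitInterval) : ZR r = Z r := (hZ r).symm
  have hud (r : ℝ) : HasDerivAt uR (IccExtend zero_le_one a r) r :=
    (a.hasDerivAt_primitive r).const_add y
  have hZd (r : ℝ) : HasDerivAt ZR (IccExtend zero_le_one b r) r := b.hasDerivAt_primitive r
  set c : ℝ → T := fun r => t₀ + r • τ with hc
  have hcd (r : ℝ) : HasDerivAt c τ r := by
    have := ((hasDerivAt_id r).smul_const τ).const_add t₀
    rwa [one_smul] at this
  have hpd (r : ℝ) : HasDerivAt (fun r => (c r, uR r)) (τ, IccExtend zero_le_one a r) r :=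
    (hcd r).prodMk (hud r)
  have hAd (r : ℝ) : HasDerivAt (fun r => A (c r, uR r) w)
      (fderiv ℝ A (c r, uR r) (τ, IccExtend zero_le_one a r) w) r := by
    have h1 := ((hA.differentiable (by simp) (c r, uR r)).hasFDerivAt).comp_hasDerivAt r (hpd r)
    simpa using h1.clm_apply (hasDerivAt_const r w)
  -- The defect `Y` satisfies the linear homogeneous equation `Y' = DA (0, Y) τ` with `Y 0 = 0`, so
  -- it vanishes by Grönwall.
  set Y : ℝ → E := fun r => ZR r - r • A (c r, uR r) w with hY
  have hYd (r : ℝ) : HasDerivAt Y (IccExtend zero_le_one b r -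
      (r • fderiv ℝ A (c r, uR r) (τ, IccExtend zero_le_one a r) w + (1 : ℝ) • A (c r, uR r) w)) r :=
    (hZd r).sub ((hasDerivAt_id r).smul (hAd r))
  have hYd' (r : ℝ) (hr : r ∈ Icc (0 : ℝ) 1) :
      HasDerivAt Y (fderiv ℝ A (c r, uR r) (0, Y r) τ) r := by
    convert hYd r using 1
    have hs := hsym ⟨r, hr⟩ w τ
    have e1 := huR' ⟨r, hr⟩
    have e2 := hZR' ⟨r, hr⟩
    simp only at hs e1 e2
    rw [IccExtend_of_mem _ _ hr, IccExtend_of_mem _ _ hr, ha, hb]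
    simp only [hY]
    rw [e1, e2]
    -- Splitting off `r • (w, A w)` lets the symmetry exchange `w` and `τ`; this turns the term into
    -- the derivative of `A w` along the ray.
    have e3 : ((0 : T), Z ⟨r, hr⟩ - r • A (c r, u ⟨r, hr⟩) w) =
        (r • w, Z ⟨r, hr⟩) - r • (w, A (c r, u ⟨r, hr⟩) w) := by ext <;> simp
    rw [e3, map_sub, map_smul, sub_apply, smul_apply, hs]
    simp only [hc]
    rw [one_smul]
    abel
  have hfc : Continuous fun r => fderiv ℝ A (c r, uR r) := by
    refine (hA.continuous_fderiv (by simp)).comp ?_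
    exact continuous_iff_continuousAt.2 fun r => (hpd r).continuousAt
  obtain ⟨C, hC⟩ := (isCompact_Icc (a := (0 : ℝ)) (b := 1)).exists_bound_of_continuousOn
    (E := T × E →L[ℝ] T →L[ℝ] E) hfc.continuousOn
  have key := eq_zero_of_abs_deriv_le_mul_abs_self_of_eq_zero_right (f := Y) (a := 0) (b := 1)
    (K := C * ‖τ‖) (f' := fun r => fderiv ℝ A (c r, uR r) (0, Y r) τ)
    (fun r hr => (hYd' r hr).continuousAt.continuousWithinAt)
    (fun r hr => (hYd' r (Ico_subset_Icc_self hr)).hasDerivWithinAt)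
    (by simp [hY, hZR])
    (fun r hr => by
      have h1 := hC r (Ico_subset_Icc_self hr)
      calc ‖fderiv ℝ A (c r, uR r) (0, Y r) τ‖
          ≤ ‖fderiv ℝ A (c r, uR r) (0, Y r)‖ * ‖τ‖ := ContinuousLinearMap.le_opNorm _ _
        _ ≤ (‖fderiv ℝ A (c r, uR r)‖ * ‖((0 : T), Y r)‖) * ‖τ‖ := by
          gcongr; exact ContinuousLinearMap.le_opNorm _ _
        _ ≤ (C * ‖Y r‖) * ‖τ‖ := by
          gcongr
          · exact (norm_nonneg _).trans h1
          rw [Prod.norm_mk, norm_zero]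
          exact max_le (norm_nonneg _) le_rfl
        _ = C * ‖τ‖ * ‖Y r‖ := by ring) 1 (by simp)
  have e1 := huR' 1
  have e2 := hZR' 1
  simp only [hY, hc, one_smul, sub_eq_zero] at key
  simp only [Icc.coe_one] at e1 e2
  rw [← e2, key, e1]

/-- The unknown is the curve `u r = y + ∫₀ʳ A (t₀ + ρ τ, u ρ) τ dρ` on the fixed interval `[0, 1]`,
with parameters `(t₀, τ, y)`. For `τ = 0` the solution is constant and the linearisation in `u` is
the identity, so the implicit function theorem applies there. Evaluation at `r = 1` with `τ = t -
t₀` gives the flow. -/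
theorem exists_local_flow {T E : Type u} [NormedAddCommGroup T] [NormedSpace ℝ T] [CompleteSpace T]
    [NormedAddCommGroup E] [NormedSpace ℝ E] [CompleteSpace E] {A : T × E → T →L[ℝ] E}
    (hA : ContDiff ℝ ∞ A) {t₁ : T} {y₁ : E}
    (hsym : ∀ᶠ p in 𝓝 (t₁, y₁), ∀ v w, fderiv ℝ A p (v, A p v) w = fderiv ℝ A p (w, A p w) v) :
    ∃ g : T × T × E → E,
      (∀ᶠ q in 𝓝 (t₁, t₁, y₁), ContDiffAt ℝ ∞ g q ∧
        HasFDerivAt (fun t => g (t, q.2)) (A (q.1, g q)) q.1) ∧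
      ∀ᶠ z in 𝓝 (t₁, y₁), g (z.1, z) = z.2 := by
  have hf : ContDiff ℝ ∞ fun x : T × E × T => A (x.1, x.2.1) x.2.2 :=
    (hA.comp (contDiff_fst.prodMk (contDiff_fst.comp contDiff_snd))).clm_apply
      (contDiff_snd.comp contDiff_snd)
  let f : C(T × E × T, E) := ⟨fun x => A (x.1, x.2.1) x.2.2, hf.continuous⟩
  let f' : C(T × E × T, T × E × T →L[ℝ] E) := ⟨fderiv ℝ f, hf.continuous_fderiv (by simp)⟩
  have hf' : ∀ x, HasFDerivAt f (f' x) x := fun x => (hf.differentiable (by simp) x).hasFDerivAt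
  have hf'v (x d : T × E × T) : f' x d =
      fderiv ℝ A (x.1, x.2.1) (d.1, d.2.1) x.2.2 + A (x.1, x.2.1) d.2.2 := by
    have h1 : HasFDerivAt (fun x : T × E × T => (x.1, x.2.1))
      ((ContinuousLinearMap.fst ℝ T (E × T)).prod
        ((ContinuousLinearMap.fst ℝ E T).comp (ContinuousLinearMap.snd ℝ T (E × T)))) x :=
      hasFDerivAt_fst.prodMk (hasFDerivAt_fst.comp x hasFDerivAt_snd)
    have h2 := (hA.differentiable (by simp) (x.1, x.2.1)).hasFDerivAt.comp x h1
    have h3 : HasFDerivAt (fun x : T × E × T => x.2.2)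
      ((ContinuousLinearMap.snd ℝ E T).comp (ContinuousLinearMap.snd ℝ T (E × T))) x :=
      hasFDerivAt_snd.comp x hasFDerivAt_snd
    rw [(hf' x).unique (h2.clm_apply h3)]
    simp [add_comm]
  let Lin : (T × T × E) × C(unitInterval, E) →L[ℝ] C(unitInterval, T × E × T) :=
    { toFun := fun q => ⟨fun r => (q.1.1 + (r : ℝ) • q.1.2.1, q.2 r, q.1.2.1), by fun_prop⟩
      map_add' := fun q q' => by
        ext r
        · change q.1.1 + q'.1.1 + (r : ℝ) • (q.1.2.1 + q'.1.2.1) =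
            (q.1.1 + (r : ℝ) • q.1.2.1) + (q'.1.1 + (r : ℝ) • q'.1.2.1)
          rw [smul_add]
          abel
        · rfl
        · rfl
      map_smul' := fun k q => by
        ext r
        · change k • q.1.1 + (r : ℝ) • (k • q.1.2.1) = k • (q.1.1 + (r : ℝ) • q.1.2.1)
          rw [smul_add, smul_comm]
        · rfl
        · rfl
      cont := by
        refine ContinuousMap.continuous_of_continuous_uncurry _ ?_
        simp only [Function.uncurry_def, ContinuousMap.coe_mk]
        fun_prop }
  have hLin (q : (T × T × E) × C(unitInterval, E)) (r : unitInterval) :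
    Lin q r = (q.1.1 + (r : ℝ) • q.1.2.1, q.2 r, q.1.2.1) := rfl
  let c : E →L[ℝ] C(unitInterval, E) :=
    { toFun := fun y => ContinuousMap.const _ y
      map_add' := fun _ _ => rfl
      map_smul' := fun _ _ => rfl
      cont := ContinuousMap.continuous_const' }
  have hc (y : E) (r : unitInterval) : c y r = y := rfl
  let J := ContinuousMap.primitiveL E
  let cy : (T × T × E) →L[ℝ] C(unitInterval, E) := c.comp
    ((ContinuousLinearMap.snd ℝ T E).comp (ContinuousLinearMap.snd ℝ T (T × E)))
  let N : (T × T × E) × C(unitInterval, E) → C(unitInterval, E) :=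
    fun q => cy q.1 + J (f.comp (Lin q))
  let N' : (T × T × E) × C(unitInterval, E) → ((T × T × E) × C(unitInterval, E) →L[ℝ] C(unitInterval, E)) :=
    fun q => cy.comp (ContinuousLinearMap.fst ℝ (T × T × E) C(unitInterval, E)) +
    J.comp ((ContinuousMap.clmApplyL _ _ (f'.comp (Lin q))).comp Lin)
  have hNd (q : (T × T × E) × C(unitInterval, E)) : HasFDerivAt N (N' q) q := by
    have h1 := (ContinuousMap.hasFDerivAt_comp_left f f' hf' (Lin q)).comp q Lin.hasFDerivAt
    exact (cy.comp (ContinuousLinearMap.fst ℝ (T × T × E) C(unitInterval, E))).hasFDerivAt.add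
      (J.hasFDerivAt.comp q h1)
  have hN : ContDiff ℝ ∞ N :=
    (cy.contDiff.comp contDiff_fst).add
      (J.contDiff.comp ((ContinuousMap.contDiff_comp_left f hf).comp Lin.contDiff))
  let p₁ : T × T × E := (t₁, 0, y₁)
  have hN1 : N (p₁, c y₁) = c y₁ := by
    have : f.comp (Lin (p₁, c y₁)) = 0 := by
      ext r
      simp [f, hLin, p₁]
    simp only [N, this, map_zero, add_zero]
    rfl
  -- Every term of the partial derivative in `u` carries the factor `τ`, which is `0` at `p₁`.
  have hN'1 : N' (p₁, c y₁) ∘L .inr ℝ (T × T × E) C(unitInterval, E) = 0 := by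
    ext1 du
    have : ContinuousMap.clmApplyL _ _ (f'.comp (Lin (p₁, c y₁))) (Lin (0, du)) = 0 := by
      ext r
      simp [hf'v, hLin, p₁]
    simp [N', this]
  obtain ⟨φ, hφ1, hφ⟩ := exists_eventually_contDiffAt_implicit
    (Ψ := fun q : (T × T × E) × C(unitInterval, E) => q.2 - N q)
    (contDiff_snd.sub hN) (p₁ := p₁) (u₁ := c y₁) (by simp [hN1]) (by
      have hd : HasFDerivAt (fun q : (T × T × E) × C(unitInterval, E) => q.2 - N q)
        (ContinuousLinearMap.snd ℝ (T × T × E) C(unitInterval, E) -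
        N' (p₁, c y₁)) (p₁, c y₁) := hasFDerivAt_snd.sub (hNd _)
      rw [hd.fderiv, ContinuousLinearMap.sub_comp, hN'1, sub_zero]
      exact ⟨ContinuousLinearEquiv.refl ℝ C(unitInterval, E), rfl⟩)
  have hφ' : ∀ᶠ p in 𝓝 p₁, φ p = N (p, φ p) := hφ.mono fun p hp => sub_eq_zero.1 hp.2
  have hcont : ContinuousAt φ p₁ := hφ.self_of_nhds.1.continuousAt
  -- The symmetry is known only near `(t₁, y₁)`. Since `[0, 1]` is compact, curves close to the
  -- constant one stay entirely in that region.
  have hregion : ∀ᶠ p in 𝓝 p₁, ∀ r : unitInterval, ∀ v w,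
      fderiv ℝ A (p.1 + (r : ℝ) • p.2.1, φ p r) (v, A (p.1 + (r : ℝ) • p.2.1, φ p r) v) w =
      fderiv ℝ A (p.1 + (r : ℝ) • p.2.1, φ p r) (w, A (p.1 + (r : ℝ) • p.2.1, φ p r) w) v := by
    obtain ⟨O, hO, hOo, hO1⟩ := mem_nhds_iff.1 hsym
    let O' : Set (T × E × T) := (fun x => (x.1, x.2.1)) ⁻¹' O
    have hO' : IsOpen O' := hOo.preimage (by fun_prop)
    have h1 := ContinuousMap.isOpen_setOfPred_mapsTo (X := unitInterval) isCompact_univ hO'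
    have h2 : ContinuousAt (fun p => Lin (p, φ p)) p₁ :=
      Lin.continuous.continuousAt.comp (continuousAt_id.prodMk hcont)
    have h3 := h2.preimage_mem_nhds (h1.mem_nhds (by
      intro r _
      simpa [O', hLin, hφ1, p₁, hc] using hO1))
    filter_upwards [h3] with p hp r
    exact hO (hp (mem_univ r))
  have hmain : ∀ᶠ p in 𝓝 p₁, ∀ w, fderiv ℝ φ p (0, w, 0) 1 = A (p.1 + p.2.1, φ p 1) w := by
    filter_upwards [hφ, hφ'.eventually_nhds, hregion] with p hp1 hp2 hp3 w
    have hd : HasFDerivAt φ (fderiv ℝ φ p) p := (hp1.1.differentiableAt (by simp)).hasFDerivAt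
    have hd2 : HasFDerivAt φ _ p :=
      (HasFDerivAt.comp (g := N) (f := fun p => (p, φ p)) p (hNd (p, φ p))
        ((hasFDerivAt_id p).prodMk hd)).congr_of_eventuallyEq hp2
    set Z := fderiv ℝ φ p (0, w, 0) with hZdef
    have hZ : Z = J (ContinuousMap.clmApplyL _ _ (f'.comp (Lin (p, φ p))) (Lin ((0, w, 0), Z))) := by
      have := congrArg (fun L : (T × T × E) →L[ℝ] C(unitInterval, E) => L (0, w, 0))
        (hd.unique hd2)
      have h0 : cy (0, w, 0) = 0 := map_zero c
      simpa [N', h0, ← hZdef] using this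
    have hu : φ p = cy p + J (f.comp (Lin (p, φ p))) := hp2.self_of_nhds
    refine variation_eq_of_integrable hA (t₀ := p.1) (τ := p.2.1) (u := φ p) (y := p.2.2)
      (a := f.comp (Lin (p, φ p)))
      (b := ContinuousMap.clmApplyL _ _ (f'.comp (Lin (p, φ p))) (Lin ((0, w, 0), Z)))
      (fun r => rfl) (fun r => ?_) (fun r => ?_) (fun r => ?_) hp3
    · simp [hf'v, hLin]
    · exact DFunLike.congr_fun hu r
    · exact DFunLike.congr_fun hZ r
  let ev : C(unitInterval, E) →L[ℝ] E := ContinuousMap.evalCLM ℝ (1 : unitInterval)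
  -- `θ` turns (end time, initial time, initial value) into (initial time, ray direction, initial
  -- value).
  let θ : T × T × E → T × T × E := fun q => (q.2.1, q.1 - q.2.1, q.2.2)
  have hθ : ContDiff ℝ ∞ θ := by
    simp only [θ]
    fun_prop
  have hθ1 : θ (t₁, t₁, y₁) = p₁ := by simp [θ, p₁]
  have hθt : Tendsto θ (𝓝 (t₁, t₁, y₁)) (𝓝 p₁) := hθ1 ▸ hθ.continuous.continuousAt
  refine ⟨fun q => φ (θ q) 1, ?_, ?_⟩
  · filter_upwards [hθt.eventually hφ, hθt.eventually hmain] with q hq1 hq2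
    constructor
    · exact ev.contDiff.contDiffAt.comp q (hq1.1.comp q hθ.contDiffAt)
    · have hd : HasFDerivAt φ (fderiv ℝ φ (θ q)) (θ q) :=
        (hq1.1.differentiableAt (by simp)).hasFDerivAt
      have h1 : HasFDerivAt (fun t => θ (t, q.2)) ((0 : T →L[ℝ] T).prod
          ((ContinuousLinearMap.id ℝ T).prod (0 : T →L[ℝ] E))) q.1 :=
        (hasFDerivAt_const q.2.1 q.1).prodMk (((hasFDerivAt_id q.1).sub_const q.2.1).prodMk
          (hasFDerivAt_const q.2.2 q.1))
      have h2 := ev.hasFDerivAt.comp q.1 (HasFDerivAt.comp (g := φ) q.1 hd h1)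
      have h3 : A (q.1, φ (θ q) 1) = ev ∘L (fderiv ℝ φ (θ q) ∘L (0 : T →L[ℝ] T).prod
          ((ContinuousLinearMap.id ℝ T).prod (0 : T →L[ℝ] E))) := by
        ext w
        have := hq2 w
        simp only [θ, add_sub_cancel] at this
        exact this.symm
      rw [h3]
      exact h2
  · have hT : Tendsto (fun z : T × E => ((z.1, 0, z.2) : T × T × E)) (𝓝 (t₁, y₁)) (𝓝 p₁) :=
      Continuous.tendsto (by fun_prop) _
    filter_upwards [hT.eventually hφ'] with z hz
    have h0 : f.comp (Lin ((z.1, 0, z.2), φ (z.1, 0, z.2))) = 0 := by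
      ext r
      simp [f, hLin]
    simp only [N, h0, map_zero, add_zero] at hz
    have := DFunLike.congr_fun hz 1
    simp only [θ, sub_self]
    exact this

end LocalFlow

/-! ### The system as a total differential equation -/

namespace PolyvectorField

variable {s n : ℕ} {N : Type*} [TopologicalSpace N]
  [ChartedSpace (EuclideanSpace ℝ (Fin n)) N] [IsManifold (𝓡 n) ∞ N]

/-- The components of `X` gathered into one linear map `v ↦ ∑ v_π X_π (t, x)`. -/
noncomputable def total (X : PolyvectorField s n N) (t : EuclideanSpace ℝ (Fin s)) (x : N) :
    EuclideanSpace ℝ (Fin s) →L[ℝ] TangentSpace (𝓡 n) x :=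
  ∑ π, (EuclideanSpace.proj π : EuclideanSpace ℝ (Fin s) →L[ℝ] ℝ).smulRight (X.comp π t x)

theorem total_apply (X : PolyvectorField s n N) (t v : EuclideanSpace ℝ (Fin s)) (x : N) :
    X.total t x v = ∑ π, v π • X.comp π t x := by
  simp [total, sum_apply]

theorem total_single (X : PolyvectorField s n N) (t : EuclideanSpace ℝ (Fin s)) (x : N)
    (π : Fin s) : X.total t x (EuclideanSpace.single π (1 : ℝ)) = X.comp π t x := by
  rw [total_apply, Finset.sum_eq_single π] <;> simp +contextual

theorem eq_total (X : PolyvectorField s n N) {t : EuclideanSpace ℝ (Fin s)} {x : N}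
    {L : EuclideanSpace ℝ (Fin s) →L[ℝ] TangentSpace (𝓡 n) x}
    (h : ∀ π, L (EuclideanSpace.single π (1 : ℝ)) = X.comp π t x) : L = X.total t x := by
  ext v
  have hv : v = ∑ π, v π • EuclideanSpace.single π (1 : ℝ) := by
    ext i
    simp [Finset.sum_apply, Pi.single_apply]
  rw [hv, map_sum, map_sum]
  exact Finset.sum_congr rfl fun π _ => by rw [map_smul, map_smul, h, total_single]

theorem contMDiff_autonomised (X : PolyvectorField s n N) (π : Fin s) :
    ContMDiff ((𝓡 s).prod (𝓡 n)) ((𝓡 s).prod (𝓡 n)).tangent ∞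
      (fun p : EuclideanSpace ℝ (Fin s) × N =>
        (⟨p, X.autonomised π p⟩ : TangentBundle ((𝓡 s).prod (𝓡 n))
          (EuclideanSpace ℝ (Fin s) × N))) := by
  have h1 : ContMDiff ((𝓡 s).prod (𝓡 n)) (𝓡 s).tangent ∞
      (fun p : EuclideanSpace ℝ (Fin s) × N =>
        (⟨p.1, EuclideanSpace.single π (1 : ℝ)⟩ :
          TangentBundle (𝓡 s) (EuclideanSpace ℝ (Fin s)))) := by
    have h0 : ContMDiff (𝓡 s) (𝓡 s).tangent ∞ (fun t : EuclideanSpace ℝ (Fin s) =>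
        (⟨t, EuclideanSpace.single π (1 : ℝ)⟩ :
          TangentBundle (𝓡 s) (EuclideanSpace ℝ (Fin s)))) :=
      contMDiff_vectorSpace_iff_contDiff.2 contDiff_const
    exact h0.comp contMDiff_fst
  exact contMDiff_equivTangentBundleProd_symm.comp (h1.prodMk (X.smooth_comp π))

/-- The vector field `(v, X_v)` on `ℝ^s × N`, for a constant `v`. -/
noncomputable def lift (X : PolyvectorField s n N) (v : EuclideanSpace ℝ (Fin s))
    (p : EuclideanSpace ℝ (Fin s) × N) : TangentSpace ((𝓡 s).prod (𝓡 n)) p :=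
  (v, X.total p.1 p.2 v)

theorem lift_eq_sum (X : PolyvectorField s n N) (v : EuclideanSpace ℝ (Fin s))
    (p : EuclideanSpace ℝ (Fin s) × N) : X.lift v p = ∑ π, v π • X.autonomised π p := by
  refine Prod.ext ?_ ?_
  · refine Eq.trans ?_ (map_sum (LinearMap.fst ℝ (EuclideanSpace ℝ (Fin s))
      (EuclideanSpace ℝ (Fin n))) (fun π => v π • X.autonomised π p) Finset.univ).symm
    change v = ∑ π, v π • EuclideanSpace.single π (1 : ℝ)
    ext i
    simp [Finset.sum_apply, Pi.single_apply]
  · refine Eq.trans ?_ (map_sum (LinearMap.snd ℝ (EuclideanSpace ℝ (Fin s))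
      (EuclideanSpace ℝ (Fin n))) (fun π => v π • X.autonomised π p) Finset.univ).symm
    exact X.total_apply p.1 v p.2

theorem contMDiff_lift (X : PolyvectorField s n N) (v : EuclideanSpace ℝ (Fin s)) :
    ContMDiff ((𝓡 s).prod (𝓡 n)) ((𝓡 s).prod (𝓡 n)).tangent ∞
      (fun p : EuclideanSpace ℝ (Fin s) × N =>
        (⟨p, X.lift v p⟩ : TangentBundle ((𝓡 s).prod (𝓡 n)) (EuclideanSpace ℝ (Fin s) × N))) := by
  simp only [lift_eq_sum]
  exact ContMDiff.sum_section fun π _ =>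
    (contMDiff_const (c := v π)).smul_section (X.contMDiff_autonomised π)

/-! ### Solutions and their uniqueness -/

/-- `γ` solves the system on the set `U`. -/
def IsSolutionOn (X : PolyvectorField s n N) (γ : EuclideanSpace ℝ (Fin s) → N)
    (U : Set (EuclideanSpace ℝ (Fin s))) : Prop :=
  ∀ t ∈ U, HasMFDerivAt (𝓡 s) (𝓡 n) γ t (X.total t (γ t))

theorem IsSolution.isSolutionOn {X : PolyvectorField s n N} {γ : EuclideanSpace ℝ (Fin s) → N}
    (h : X.IsSolution γ) : X.IsSolutionOn γ univ := by
  intro t _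
  have := (h.1 t).hasMFDerivAt
  rwa [X.eq_total (L := mfderiv (𝓡 s) (𝓡 n) γ t) (fun π => h.2 π t)] at this

theorem IsSolutionOn.mono {X : PolyvectorField s n N} {γ : EuclideanSpace ℝ (Fin s) → N}
    {U V : Set (EuclideanSpace ℝ (Fin s))} (h : X.IsSolutionOn γ U) (hV : V ⊆ U) :
    X.IsSolutionOn γ V := fun t ht => h t (hV ht)

/-- Restriction to a line reduces the system to an autonomous ODE on `ℝ^s × N`, for which uniqueness
is classical. -/
theorem IsSolutionOn.isMIntegralCurveOn {X : PolyvectorField s n N}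
    {γ : EuclideanSpace ℝ (Fin s) → N} {U : Set (EuclideanSpace ℝ (Fin s))}
    (h : X.IsSolutionOn γ U) (t v : EuclideanSpace ℝ (Fin s)) {J : Set ℝ}
    (hJ : ∀ r ∈ J, t + r • v ∈ U) :
    IsMIntegralCurveOn (I := (𝓡 s).prod (𝓡 n)) (fun r : ℝ => (t + r • v, γ (t + r • v)))
      (X.lift v) J := by
  intro r hr
  have h1 : HasMFDerivAt 𝓘(ℝ, ℝ) (𝓡 s) (fun r : ℝ => t + r • v) r
      ((1 : ℝ →L[ℝ] ℝ).smulRight v) := by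
    refine HasFDerivAt.hasMFDerivAt ?_
    have : HasFDerivAt (fun r : ℝ => r • v) ((1 : ℝ →L[ℝ] ℝ).smulRight v) r :=
      (hasFDerivAt_id r).smul_const v
    exact this.const_add t
  have h2 := (h _ (hJ r hr)).comp r h1
  have h3 := h1.prodMk h2
  refine HasMFDerivAt.hasMFDerivWithinAt ?_
  have h4 : ((1 : ℝ →L[ℝ] ℝ).smulRight (X.lift v (t + r • v, γ (t + r • v))) :
      ℝ →L[ℝ] EuclideanSpace ℝ (Fin s) × EuclideanSpace ℝ (Fin n)) =
      ((1 : ℝ →L[ℝ] ℝ).smulRight v).prod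
        ((X.total (t + r • v) (γ (t + r • v))).comp ((1 : ℝ →L[ℝ] ℝ).smulRight v)) := by
    refine ContinuousLinearMap.ext_ring (Prod.ext rfl ?_)
    change (1 : ℝ) • X.total (t + r • v) (γ (t + r • v)) v =
      X.total (t + r • v) (γ (t + r • v)) ((1 : ℝ) • v)
    rw [one_smul, one_smul]
  exact (congrArg (HasMFDerivAt 𝓘(ℝ, ℝ) ((𝓡 s).prod (𝓡 n))
    (fun r : ℝ => (t + r • v, γ (t + r • v))) r) h4).mpr h3

theorem IsSolutionOn.eq_of_convex [T2Space N] {X : PolyvectorField s n N}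
    {γ γ' : EuclideanSpace ℝ (Fin s) → N} {U : Set (EuclideanSpace ℝ (Fin s))} (hU : IsOpen U)
    (hc : Convex ℝ U) (h : X.IsSolutionOn γ U) (h' : X.IsSolutionOn γ' U)
    {t t' : EuclideanSpace ℝ (Fin s)} (ht : t ∈ U) (ht' : t' ∈ U) (heq : γ t = γ' t) :
    γ t' = γ' t' := by
  set v := t' - t with hv
  set c : ℝ → EuclideanSpace ℝ (Fin s) := fun r => t + r • v with hcdef
  have hcc : Continuous c := by fun_prop
  have hpre : IsOpen (c ⁻¹' U) := hU.preimage hcc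
  have hpc : Convex ℝ (c ⁻¹' U) := by
    intro a ha b hb α β hα hβ hαβ
    have := hc ha hb hα hβ hαβ
    simp only [mem_preimage, hcdef] at this ⊢
    convert this using 1
    have : t = (α + β) • t := by rw [hαβ, one_smul]
    nth_rw 1 [this]
    simp only [smul_eq_mul, add_smul, smul_add, mul_smul]
    abel
  have h0 : (0 : ℝ) ∈ c ⁻¹' U := by simpa [hcdef] using ht
  have h1 : (1 : ℝ) ∈ c ⁻¹' U := by simpa [hcdef, hv] using ht'
  -- Uniqueness is used on an open interval, so the segment is extended slightly past both ends.
  obtain ⟨a, ha, ha'⟩ : ∃ a < (0 : ℝ), a ∈ c ⁻¹' U := by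
    obtain ⟨ε, hε, hb⟩ := Metric.isOpen_iff.1 hpre 0 h0
    exact ⟨-(ε / 2), by linarith, hb (by simp [abs_of_pos hε, hε])⟩
  obtain ⟨b, hb, hb'⟩ : ∃ b > (1 : ℝ), b ∈ c ⁻¹' U := by
    obtain ⟨ε, hε, hb⟩ := Metric.isOpen_iff.1 hpre 1 h1
    exact ⟨1 + ε / 2, by linarith, hb (by simp [abs_of_pos hε, hε])⟩
  have hsub : ∀ r ∈ Ioo a b, c r ∈ U := fun r hr =>
    hpc.ordConnected.out ha' hb' (Ioo_subset_Icc_self hr)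
  have key := isMIntegralCurveOn_Ioo_eqOn_of_contMDiff_boundaryless
    (I := (𝓡 s).prod (𝓡 n)) (t₀ := (0 : ℝ)) (a := a) (b := b) ⟨ha, by linarith⟩
    ((X.contMDiff_lift v).of_le (by norm_cast)) (h.isMIntegralCurveOn t v hsub)
    (h'.isMIntegralCurveOn t v hsub) (by simp [heq])
  have := congrArg Prod.snd (key (show (1 : ℝ) ∈ Ioo a b from ⟨by linarith, hb⟩))
  simpa [hv] using this

/-! ### The flow and its algebra -/

/-- `γ` is a solution through `(q.2.1, q.2.2)` on a convex open set that contains `q.1`. -/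
def Joins (X : PolyvectorField s n N)
    (q : EuclideanSpace ℝ (Fin s) × EuclideanSpace ℝ (Fin s) × N)
    (γ : EuclideanSpace ℝ (Fin s) → N) : Prop :=
  ∃ U : Set (EuclideanSpace ℝ (Fin s)), IsOpen U ∧ Convex ℝ U ∧ q.1 ∈ U ∧ q.2.1 ∈ U ∧
    X.IsSolutionOn γ U ∧ γ q.2.1 = q.2.2

/-- The triples `(t, t₀, x)` such that the solution through `(t₀, x)` reaches the time `t`. -/
def flowDomain (X : PolyvectorField s n N) :
    Set (EuclideanSpace ℝ (Fin s) × EuclideanSpace ℝ (Fin s) × N) := {q | ∃ γ, X.Joins q γ}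

open Classical in
/-- The value at the time `t` of the solution through `(t₀, x)`, as a function of `(t, t₀, x)`. -/
noncomputable def flow (X : PolyvectorField s n N)
    (q : EuclideanSpace ℝ (Fin s) × EuclideanSpace ℝ (Fin s) × N) : N :=
  if h : q ∈ X.flowDomain then h.choose q.1 else q.2.2

/-- The interior of the set on which the flow is defined and smooth. -/
def flowRegular (X : PolyvectorField s n N) :
    Set (EuclideanSpace ℝ (Fin s) × EuclideanSpace ℝ (Fin s) × N) :=
  {q | ∀ᶠ q' in 𝓝 q, q' ∈ X.flowDomain ∧
    ContMDiffAt ((𝓡 s).prod ((𝓡 s).prod (𝓡 n))) (𝓡 n) ∞ X.flow q'}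

theorem isOpen_flowRegular (X : PolyvectorField s n N) : IsOpen X.flowRegular :=
  isOpen_iff_mem_nhds.2 fun _ hq => hq.eventually_nhds

theorem mem_flowDomain_of_mem_flowRegular {X : PolyvectorField s n N}
    {q : EuclideanSpace ℝ (Fin s) × EuclideanSpace ℝ (Fin s) × N} (hq : q ∈ X.flowRegular) :
    q ∈ X.flowDomain := hq.self_of_nhds.1

theorem contMDiffAt_flow {X : PolyvectorField s n N}
    {q : EuclideanSpace ℝ (Fin s) × EuclideanSpace ℝ (Fin s) × N} (hq : q ∈ X.flowRegular) :
    ContMDiffAt ((𝓡 s).prod ((𝓡 s).prod (𝓡 n))) (𝓡 n) ∞ X.flow q := hq.self_of_nhds.2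

/-- The chosen solution is irrelevant: the intersection of two convex domains is convex, so
uniqueness holds on it. -/
theorem Joins.flow_eq [T2Space N] {X : PolyvectorField s n N}
    {q : EuclideanSpace ℝ (Fin s) × EuclideanSpace ℝ (Fin s) × N}
    {γ : EuclideanSpace ℝ (Fin s) → N} (h : X.Joins q γ) : X.flow q = γ q.1 := by
  have hq : q ∈ X.flowDomain := ⟨γ, h⟩
  rw [flow, dif_pos hq]
  obtain ⟨U, hU, hc, h1, h2, hs, h0⟩ := h
  obtain ⟨V, hV, hcV, h1', h2', hs', h0'⟩ := hq.choose_spec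
  exact IsSolutionOn.eq_of_convex (hV.inter hU) (hcV.inter hc) (hs'.mono inter_subset_left)
    (hs.mono inter_subset_right) ⟨h2', h2⟩ ⟨h1', h1⟩ (h0'.trans h0.symm)

theorem flow_self [T2Space N] {X : PolyvectorField s n N} {t : EuclideanSpace ℝ (Fin s)} {x : N}
    (h : (t, t, x) ∈ X.flowDomain) : X.flow (t, t, x) = x := by
  obtain ⟨γ, hγ⟩ := h
  rw [hγ.flow_eq]
  obtain ⟨U, hU, hc, h1, h2, hs, h0⟩ := hγ
  exact h0

theorem Joins.symm {X : PolyvectorField s n N} {t t₀ : EuclideanSpace ℝ (Fin s)} {x : N}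
    {γ : EuclideanSpace ℝ (Fin s) → N} (h : X.Joins (t, t₀, x) γ) : X.Joins (t₀, t, γ t) γ := by
  obtain ⟨U, hU, hc, h1, h2, hs, h0⟩ := h
  exact ⟨U, hU, hc, h2, h1, hs, rfl⟩

theorem flow_flow [T2Space N] {X : PolyvectorField s n N} {t t₀ : EuclideanSpace ℝ (Fin s)} {x : N}
    (h : (t, t₀, x) ∈ X.flowDomain) : X.flow (t₀, t, X.flow (t, t₀, x)) = x := by
  obtain ⟨γ, hγ⟩ := h
  rw [hγ.flow_eq, hγ.symm.flow_eq]
  obtain ⟨U, hU, hc, h1, h2, hs, h0⟩ := hγ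
  exact h0

theorem hasMFDerivAt_flow [T2Space N] {X : PolyvectorField s n N}
    {t t₀ : EuclideanSpace ℝ (Fin s)} {x : N} (h : (t, t₀, x) ∈ X.flowDomain) :
    HasMFDerivAt (𝓡 s) (𝓡 n) (fun t => X.flow (t, t₀, x)) t (X.total t (X.flow (t, t₀, x))) := by
  obtain ⟨γ, hγ⟩ := h
  rw [hγ.flow_eq]
  obtain ⟨U, hU, hc, h1, h2, hs, h0⟩ := hγ
  refine (hs t h1).congr_of_eventuallyEq ?_
  filter_upwards [hU.mem_nhds h1] with t' ht'
  exact Joins.flow_eq ⟨U, hU, hc, ht', h2, hs, h0⟩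

/-! ### The flow under global solvability -/

theorem HasGlobalSolutions.exists_joins {X : PolyvectorField s n N} (h : X.HasGlobalSolutions)
    (t₀ : EuclideanSpace ℝ (Fin s)) (x : N) :
    ∃ γ, Continuous γ ∧ γ t₀ = x ∧ ∀ t t', X.Joins (t, t', γ t') γ := by
  obtain ⟨γ, hγ, h0⟩ := h t₀ x
  exact ⟨γ, hγ.1.continuous, h0, fun t t' =>
    ⟨univ, isOpen_univ, convex_univ, trivial, trivial, hγ.isSolutionOn, rfl⟩⟩

theorem HasGlobalSolutions.flow_trans [T2Space N] {X : PolyvectorField s n N}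
    (h : X.HasGlobalSolutions) (t t₁ t₀ : EuclideanSpace ℝ (Fin s)) (x : N) :
    X.flow (t, t₁, X.flow (t₁, t₀, x)) = X.flow (t, t₀, x) := by
  obtain ⟨γ, -, rfl, hγ⟩ := h.exists_joins t₀ x
  rw [(hγ t₁ t₀).flow_eq, (hγ t t₁).flow_eq, (hγ t t₀).flow_eq]

theorem HasGlobalSolutions.flowDomain_eq {X : PolyvectorField s n N}
    (h : X.HasGlobalSolutions) : X.flowDomain = univ := by
  refine eq_univ_of_forall fun ⟨t, t₀, x⟩ => ?_
  obtain ⟨γ, -, rfl, hγ⟩ := h.exists_joins t₀ x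
  exact ⟨γ, hγ t t₀⟩

/-- For fixed `(t₀, x)` the regular times form an open set containing `t₀`. It is closed because the
flow up to a limit time `t₁` factors through a nearby regular time `t₂`, followed by a short flow
near the diagonal. -/
theorem HasGlobalSolutions.flowRegular_eq [T2Space N] {X : PolyvectorField s n N}
    (h : X.HasGlobalSolutions) (hdiag : ∀ t x, (t, t, x) ∈ X.flowRegular) :
    X.flowRegular = univ := by
  refine eq_univ_of_forall fun ⟨t, t₀, x⟩ => ?_
  obtain ⟨γ, hγc, hγ0, hγ⟩ := h.exists_joins t₀ x
  have hfl (t) : X.flow (t, t₀, x) = γ t := by rw [← hγ0, (hγ t t₀).flow_eq]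
  set S : Set (EuclideanSpace ℝ (Fin s)) := {t | (t, t₀, x) ∈ X.flowRegular} with hS
  have hopen : IsOpen S := X.isOpen_flowRegular.preimage (by fun_prop)
  have hclosed : IsClosed S := by
    refine isClosed_of_closure_subset fun t₁ ht₁ => ?_
    have hc : Continuous fun t => ((t₁, t, γ t) : EuclideanSpace ℝ (Fin s) ×
      EuclideanSpace ℝ (Fin s) × N) := by fun_prop
    obtain ⟨t₂, ht₂, ht₂'⟩ := mem_closure_iff.1 ht₁ _ (X.isOpen_flowRegular.preimage hc)
      (hdiag t₁ (γ t₁))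
    have h2 : ContMDiffAt ((𝓡 s).prod ((𝓡 s).prod (𝓡 n))) (𝓡 n) ∞
        X.flow (t₁, t₂, X.flow (t₂, t₀, x)) := by
      rw [hfl]
      exact contMDiffAt_flow ht₂
    have hcont : ContinuousAt (fun q : EuclideanSpace ℝ (Fin s) × EuclideanSpace ℝ (Fin s) × N =>
        (t₂, q.2)) (t₁, t₀, x) := by fun_prop
    have hcont2 : ContinuousAt (fun q : EuclideanSpace ℝ (Fin s) × EuclideanSpace ℝ (Fin s) × N =>
        (q.1, t₂, X.flow (t₂, q.2))) (t₁, t₀, x) := by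
      have h3 : ContinuousAt (fun q : EuclideanSpace ℝ (Fin s) × EuclideanSpace ℝ (Fin s) × N =>
        X.flow (t₂, q.2)) (t₁, t₀, x) := ContinuousAt.comp (g := X.flow) (f := fun q :
          EuclideanSpace ℝ (Fin s) × EuclideanSpace ℝ (Fin s) × N => (t₂, q.2))
          (contMDiffAt_flow ht₂').continuousAt hcont
      fun_prop
    have e1 := hcont.preimage_mem_nhds (X.isOpen_flowRegular.mem_nhds ht₂')
    have e2 := hcont2.preimage_mem_nhds (X.isOpen_flowRegular.mem_nhds
      (show (t₁, t₂, X.flow (t₂, t₀, x)) ∈ X.flowRegular by rw [hfl]; exact ht₂))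
    change ∀ᶠ q in 𝓝 (t₁, t₀, x), _
    filter_upwards [e1, e2] with q hq1 hq2
    refine ⟨by rw [h.flowDomain_eq]; trivial, ?_⟩
    have e3 : X.flow = fun q => X.flow (q.1, t₂, X.flow (t₂, q.2)) := by
      ext q
      exact (h.flow_trans _ _ _ _).symm
    rw [e3]
    have e4 : ContMDiffAt ((𝓡 s).prod ((𝓡 s).prod (𝓡 n))) (𝓡 n) ∞
        (fun q : EuclideanSpace ℝ (Fin s) × EuclideanSpace ℝ (Fin s) × N => X.flow (t₂, q.2)) q :=
      ContMDiffAt.comp (g := X.flow) q (contMDiffAt_flow hq1)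
        (contMDiffAt_const.prodMk contMDiffAt_snd)
    exact ContMDiffAt.comp (g := X.flow) q (contMDiffAt_flow hq2)
      (contMDiffAt_fst.prodMk (contMDiffAt_const.prodMk e4))
  have : S = univ := IsClopen.eq_univ ⟨hclosed, hopen⟩ ⟨t₀, hdiag t₀ x⟩
  exact (this.symm ▸ mem_univ t : t ∈ S)

end PolyvectorField

/-- A cutoff makes the chart expression smooth on the whole vector space, as the superposition
operator requires, without changing its germ. -/
theorem ContDiffOn.exists_contDiff_eventuallyEq {F G : Type*} [NormedAddCommGroup F]
    [NormedSpace ℝ F] [FiniteDimensional ℝ F] [NormedAddCommGroup G] [NormedSpace ℝ G] {O : Set F}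
    {A : F → G} (hA : ContDiffOn ℝ ∞ A O) (hO : IsOpen O) {p : F} (hp : p ∈ O) :
    ∃ B : F → G, ContDiff ℝ ∞ B ∧ B =ᶠ[𝓝 p] A := by
  obtain ⟨r, hr, hrO⟩ := Metric.nhds_basis_closedBall.mem_iff.1 (hO.mem_nhds hp)
  let χ : ContDiffBump p := ⟨r / 2, r, half_pos hr, half_lt_self hr⟩
  refine ⟨fun q => χ q • A q, contDiff_iff_contDiffAt.2 fun q => ?_, ?_⟩
  · by_cases hq : q ∈ O
    · exact χ.contDiff.contDiffAt.smul (hA.contDiffAt (hO.mem_nhds hq))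
    · have hq' : q ∉ tsupport χ := fun h => hq (hrO (by rwa [χ.tsupport_eq] at h))
      refine (contDiffAt_const (c := (0 : G))).congr_of_eventuallyEq ?_
      filter_upwards [notMem_tsupport_iff_eventuallyEq.1 hq'] with q' hq'
      rw [hq', Pi.zero_apply, zero_smul]
  · filter_upwards [χ.eventuallyEq_one] with q hq
    rw [hq, Pi.one_apply, one_smul]

/-! ### The system in a chart and smoothness near the diagonal -/

namespace PolyvectorField

variable {s n : ℕ} {N : Type*} [TopologicalSpace N]
  [ChartedSpace (EuclideanSpace ℝ (Fin n)) N] [IsManifold (𝓡 n) ∞ N]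

/-- The system in the chart at `x₁`. -/
noncomputable def chartField (X : PolyvectorField s n N) (x₁ : N)
    (p : EuclideanSpace ℝ (Fin s) × EuclideanSpace ℝ (Fin n)) :
    EuclideanSpace ℝ (Fin s) →L[ℝ] EuclideanSpace ℝ (Fin n) :=
  (mfderiv (𝓡 n) (𝓡 n) (extChartAt (𝓡 n) x₁) ((extChartAt (𝓡 n) x₁).symm p.2)).comp
    (X.total p.1 ((extChartAt (𝓡 n) x₁).symm p.2))

theorem chartField_single (X : PolyvectorField s n N) (x₁ : N)
    (p : EuclideanSpace ℝ (Fin s) × EuclideanSpace ℝ (Fin n)) (π : Fin s) :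
    X.chartField x₁ p (EuclideanSpace.single π (1 : ℝ)) =
      mfderiv (𝓡 n) (𝓡 n) (extChartAt (𝓡 n) x₁) ((extChartAt (𝓡 n) x₁).symm p.2)
        (X.comp π p.1 ((extChartAt (𝓡 n) x₁).symm p.2)) := by
  rw [← total_single]
  rfl

theorem contMDiffOn_prod_extChartAt_symm (s : ℕ) (x₁ : N) :
    ContMDiffOn 𝓘(ℝ, EuclideanSpace ℝ (Fin s) × EuclideanSpace ℝ (Fin n)) ((𝓡 s).prod (𝓡 n)) ∞
      (fun p : EuclideanSpace ℝ (Fin s) × EuclideanSpace ℝ (Fin n) =>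
        (p.1, (extChartAt (𝓡 n) x₁).symm p.2)) (univ ×ˢ (extChartAt (𝓡 n) x₁).target) := by
  refine ContMDiffOn.prodMk contDiff_fst.contMDiff.contMDiffOn ?_
  exact (contMDiffOn_extChartAt_symm x₁).comp contDiff_snd.contMDiff.contMDiffOn fun p hp => hp.2

/-- Over the chart domain the trivialization of `TN` at `x₁` is the derivative of the chart, so each
component is the fibre coordinate of a smooth map to `TN`. -/
theorem contDiffOn_chartField (X : PolyvectorField s n N) (x₁ : N) :
    ContDiffOn ℝ ∞ (X.chartField x₁) (univ ×ˢ (extChartAt (𝓡 n) x₁).target) := by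
  have h : ∀ π, ContDiffOn ℝ ∞ (fun p => X.chartField x₁ p (EuclideanSpace.single π (1 : ℝ)))
      (univ ×ˢ (extChartAt (𝓡 n) x₁).target) := by
    intro π
    rw [← contMDiffOn_iff_contDiffOn]
    have h1 := (X.smooth_comp π).comp_contMDiffOn (contMDiffOn_prod_extChartAt_symm s x₁)
    have h2 := (trivializationAt (EuclideanSpace ℝ (Fin n))
      (TangentSpace (𝓡 n) : N → Type _) x₁).contMDiffOn (IB := 𝓡 n) (n := ∞)
    have hb : ∀ p ∈ (univ : Set (EuclideanSpace ℝ (Fin s))) ×ˢ (extChartAt (𝓡 n) x₁).target,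
        (extChartAt (𝓡 n) x₁).symm p.2 ∈ (chartAt (EuclideanSpace ℝ (Fin n)) x₁).source := by
      intro p hp
      rw [← extChartAt_source (𝓡 n)]
      exact (extChartAt (𝓡 n) x₁).map_target hp.2
    have h3 := contMDiff_snd.comp_contMDiffOn (h2.comp h1 (by
      intro p hp
      rw [mem_preimage, Bundle.Trivialization.mem_source]
      exact hb p hp))
    refine h3.congr fun p hp => ?_
    have key := DFunLike.congr_fun (TangentBundle.continuousLinearMapAt_trivializationAt (I := 𝓡 n)
      (hb p hp)) (X.comp π p.1 ((extChartAt (𝓡 n) x₁).symm p.2))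
    refine (X.chartField_single x₁ p π).trans (key.symm.trans ?_)
    exact congrFun (Bundle.Trivialization.coe_linearMapAt_of_mem _ (hb p hp)) _
  have e : X.chartField x₁ = fun p => ∑ π,
      (EuclideanSpace.proj π : EuclideanSpace ℝ (Fin s) →L[ℝ] ℝ).smulRight
        (X.chartField x₁ p (EuclideanSpace.single π (1 : ℝ))) := by
    ext1 p
    simp only [chartField_single]
    unfold chartField total
    rw [ContinuousLinearMap.comp_finsetSum]
    refine Finset.sum_congr rfl fun π _ => ?_
    ext1 v
    exact map_smul (mfderiv (𝓡 n) (𝓡 n) (extChartAt (𝓡 n) x₁) ((extChartAt (𝓡 n) x₁).symm p.2))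
      (v π) _
  rw [e]
  exact ContDiffOn.sum fun π _ =>
    contDiffOn_const.smulRight (h π)

theorem hasMFDerivAt_extChartAt_symm {x₁ : N} {y : EuclideanSpace ℝ (Fin n)}
    (hy : y ∈ (extChartAt (𝓡 n) x₁).target) :
    HasMFDerivAt (𝓡 n) (𝓡 n) (extChartAt (𝓡 n) x₁).symm y
      (mfderivWithin (𝓡 n) (𝓡 n) (extChartAt (𝓡 n) x₁).symm (range (𝓡 n)) y) := by
  have : IsManifold (𝓡 n) 1 N := IsManifold.of_le (n := ∞) (by norm_cast)
  have := (mdifferentiableWithinAt_extChartAt_symm hy).hasMFDerivWithinAt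
  simpa [hasMFDerivWithinAt_univ] using this

theorem mfderivWithin_comp_chartField (X : PolyvectorField s n N) {x₁ : N}
    {p : EuclideanSpace ℝ (Fin s) × EuclideanSpace ℝ (Fin n)}
    (hp : p.2 ∈ (extChartAt (𝓡 n) x₁).target) :
    (mfderivWithin (𝓡 n) (𝓡 n) (extChartAt (𝓡 n) x₁).symm (range (𝓡 n)) p.2).comp
      (X.chartField x₁ p) = X.total p.1 ((extChartAt (𝓡 n) x₁).symm p.2) := by
  have : IsManifold (𝓡 n) 1 N := IsManifold.of_le (n := ∞) (by norm_cast)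
  have := mfderivWithin_extChartAt_symm_comp_mfderiv_extChartAt hp
  ext1 v
  exact DFunLike.congr_fun this (X.total p.1 ((extChartAt (𝓡 n) x₁).symm p.2) v)

theorem mpullback_autonomised (X : PolyvectorField s n N) {x₁ : N} (π : Fin s)
    {p : EuclideanSpace ℝ (Fin s) × EuclideanSpace ℝ (Fin n)}
    (hp : p.2 ∈ (extChartAt (𝓡 n) x₁).target) :
    VectorField.mpullback 𝓘(ℝ, EuclideanSpace ℝ (Fin s) × EuclideanSpace ℝ (Fin n))
      ((𝓡 s).prod (𝓡 n)) (fun p : EuclideanSpace ℝ (Fin s) × EuclideanSpace ℝ (Fin n) =>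
        (p.1, (extChartAt (𝓡 n) x₁).symm p.2)) (X.autonomised π) p =
      (EuclideanSpace.single π (1 : ℝ), X.chartField x₁ p (EuclideanSpace.single π (1 : ℝ))) := by
  have : IsManifold (𝓡 n) 1 N := IsManifold.of_le (n := ∞) (by norm_cast)
  obtain ⟨e', he'⟩ := isInvertible_mfderivWithin_extChartAt_symm (I := 𝓡 n) hp
  have h1 : HasMFDerivAt 𝓘(ℝ, EuclideanSpace ℝ (Fin s) × EuclideanSpace ℝ (Fin n)) (𝓡 s)
      (Prod.fst : EuclideanSpace ℝ (Fin s) × EuclideanSpace ℝ (Fin n) → _) p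
      (ContinuousLinearMap.fst ℝ (EuclideanSpace ℝ (Fin s)) (EuclideanSpace ℝ (Fin n))) :=
    hasFDerivAt_fst.hasMFDerivAt
  have h2 : HasMFDerivAt 𝓘(ℝ, EuclideanSpace ℝ (Fin s) × EuclideanSpace ℝ (Fin n)) (𝓡 n)
      (Prod.snd : EuclideanSpace ℝ (Fin s) × EuclideanSpace ℝ (Fin n) → _) p
      (ContinuousLinearMap.snd ℝ (EuclideanSpace ℝ (Fin s)) (EuclideanSpace ℝ (Fin n))) :=
    hasFDerivAt_snd.hasMFDerivAt
  have h3 := h1.prodMk ((hasMFDerivAt_extChartAt_symm hp).comp p h2)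
  rw [VectorField.mpullback_apply]
  have h4 := h3.mfderiv
  let F : (EuclideanSpace ℝ (Fin s) × EuclideanSpace ℝ (Fin n)) ≃L[ℝ]
      (EuclideanSpace ℝ (Fin s) × EuclideanSpace ℝ (Fin n)) :=
    (ContinuousLinearEquiv.refl ℝ (EuclideanSpace ℝ (Fin s))).prodCongr e'
  have h5 : mfderiv 𝓘(ℝ, EuclideanSpace ℝ (Fin s) × EuclideanSpace ℝ (Fin n))
      ((𝓡 s).prod (𝓡 n)) (fun p : EuclideanSpace ℝ (Fin s) × EuclideanSpace ℝ (Fin n) =>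
        (p.1, (extChartAt (𝓡 n) x₁).symm p.2)) p =
      (F : (EuclideanSpace ℝ (Fin s) × EuclideanSpace ℝ (Fin n)) →L[ℝ]
        (EuclideanSpace ℝ (Fin s) × EuclideanSpace ℝ (Fin n))) := by
    refine h4.trans ?_
    rw [← he']
    rfl
  have h6 : F (EuclideanSpace.single π (1 : ℝ),
      X.chartField x₁ p (EuclideanSpace.single π (1 : ℝ))) =
      X.autonomised π (p.1, (extChartAt (𝓡 n) x₁).symm p.2) := by
    have e1 := DFunLike.congr_fun (X.mfderivWithin_comp_chartField hp)
      (EuclideanSpace.single π (1 : ℝ))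
    rw [total_single, ← he'] at e1
    exact Prod.ext rfl e1
  rw [h5, ← h6]
  exact (DFunLike.congr_fun (ContinuousLinearMap.inverse_equiv F) _).trans (F.symm_apply_apply _)

/-- Pullback commutes with brackets, so the fields `V π = (e_π, A e_π)` commute. The second
component of `[V π, V ν]` is `DA (V π) e_ν - DA (V ν) e_π`; bilinearity extends the symmetry to all
`v`, `w`. -/
theorem Integrable.chartField_symm {X : PolyvectorField s n N} (h : X.Integrable) {x₁ : N}
    {p : EuclideanSpace ℝ (Fin s) × EuclideanSpace ℝ (Fin n)}
    (hp : p.2 ∈ (extChartAt (𝓡 n) x₁).target) (v w : EuclideanSpace ℝ (Fin s)) :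
    fderiv ℝ (X.chartField x₁) p (v, X.chartField x₁ p v) w =
      fderiv ℝ (X.chartField x₁) p (w, X.chartField x₁ p w) v := by
  set A := X.chartField x₁ with hA
  have hO : IsOpen ((univ : Set (EuclideanSpace ℝ (Fin s))) ×ˢ (extChartAt (𝓡 n) x₁).target) :=
    isOpen_univ.prod (isOpen_extChartAt_target x₁)
  have hnhds : (univ : Set (EuclideanSpace ℝ (Fin s))) ×ˢ (extChartAt (𝓡 n) x₁).target ∈ 𝓝 p :=
    hO.mem_nhds ⟨trivial, hp⟩
  have hAd : HasFDerivAt A (fderiv ℝ A p) p :=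
    (((X.contDiffOn_chartField x₁).contDiffAt hnhds).differentiableAt (by simp)).hasFDerivAt
  let V (π : Fin s) (q : EuclideanSpace ℝ (Fin s) × EuclideanSpace ℝ (Fin n)) :
      EuclideanSpace ℝ (Fin s) × EuclideanSpace ℝ (Fin n) :=
    (EuclideanSpace.single π (1 : ℝ), A q (EuclideanSpace.single π (1 : ℝ)))
  have hV (π : Fin s) (d) : fderiv ℝ (V π) p d =
      (0, fderiv ℝ A p d (EuclideanSpace.single π (1 : ℝ))) := by
    have h1 := (hasFDerivAt_const (EuclideanSpace.single π (1 : ℝ)) p).prodMk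
      (hAd.clm_apply (hasFDerivAt_const (EuclideanSpace.single π (1 : ℝ)) p))
    have h2 : HasFDerivAt (V π) _ p := h1
    rw [h2.fderiv]
    simp
  have hbasis (π ν : Fin s) : fderiv ℝ A p (V π p) (EuclideanSpace.single ν (1 : ℝ)) =
      fderiv ℝ A p (V ν p) (EuclideanSpace.single π (1 : ℝ)) := by
    have hpull (π : Fin s) : VectorField.mpullback
        𝓘(ℝ, EuclideanSpace ℝ (Fin s) × EuclideanSpace ℝ (Fin n))
        ((𝓡 s).prod (𝓡 n)) (fun p : EuclideanSpace ℝ (Fin s) × EuclideanSpace ℝ (Fin n) =>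
        (p.1, (extChartAt (𝓡 n) x₁).symm p.2)) (X.autonomised π) =ᶠ[𝓝 p] V π := by
      filter_upwards [hnhds] with q hq
      exact X.mpullback_autonomised π hq.2
    have h1 : VectorField.lieBracket ℝ (V π) (V ν) p = 0 := by
      have : IsManifold (𝓡 n) (minSmoothness ℝ 3) N := IsManifold.of_le (n := ∞) (by
        rw [minSmoothness_of_isRCLikeNormedField]; norm_cast)
      have e1 : VectorField.mlieBracket 𝓘(ℝ, EuclideanSpace ℝ (Fin s) × EuclideanSpace ℝ (Fin n))
          (V π) (V ν) p = VectorField.lieBracket ℝ (V π) (V ν) p := by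
        have := congrFun (VectorField.mlieBracketWithin_eq_lieBracketWithin (𝕜 := ℝ)
          (V := V π) (W := V ν) (s := univ)) p
        exact (congrFun VectorField.mlieBracketWithin_univ p).symm.trans
          (this.trans (congrFun VectorField.lieBracketWithin_univ p))
      have e2 := (hpull π).mlieBracket_vectorField_eq (hpull ν)
      have e3 := VectorField.mpullback_mlieBracket (n := ∞)
          (((X.contMDiff_autonomised π) _).mdifferentiableAt (by simp))
          (((X.contMDiff_autonomised ν) _).mdifferentiableAt (by simp))
          ((contMDiffOn_prod_extChartAt_symm s x₁).contMDiffAt hnhds)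
          (by rw [minSmoothness_of_isRCLikeNormedField]; norm_cast)
      rw [VectorField.mpullback_apply, h π ν, map_zero] at e3
      exact e1.symm.trans (e2.symm.trans e3.symm)
    rw [VectorField.lieBracket, hV, hV, Prod.mk_sub_mk, Prod.mk_eq_zero] at h1
    exact sub_eq_zero.1 h1.2
  have hsum (v : EuclideanSpace ℝ (Fin s)) :
      v = ∑ π, v π • EuclideanSpace.single π (1 : ℝ) := by
    ext i
    simp [Finset.sum_apply, Pi.single_apply]
  have hsum' (v : EuclideanSpace ℝ (Fin s)) : (v, A p v) = ∑ π, v π • V π p := by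
    refine Prod.ext ?_ ?_
    · rw [Prod.fst_sum]
      exact hsum v
    · rw [Prod.snd_sum]
      conv_lhs => rw [hsum v]
      simp [V, map_sum]
  have hexp (v w : EuclideanSpace ℝ (Fin s)) : fderiv ℝ A p (v, A p v) w =
      ∑ π, ∑ ν, (v π * w ν) • fderiv ℝ A p (V π p) (EuclideanSpace.single ν (1 : ℝ)) := by
    rw [hsum' v, map_sum, sum_apply]
    refine Finset.sum_congr rfl fun π _ => ?_
    rw [map_smul, smul_apply]
    conv_lhs => rw [hsum w]
    rw [map_sum, Finset.smul_sum]
    exact Finset.sum_congr rfl fun ν _ => by rw [map_smul, smul_smul]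
  rw [hexp, hexp, Finset.sum_comm]
  exact Finset.sum_congr rfl fun π _ => Finset.sum_congr rfl fun ν _ => by
    rw [hbasis, mul_comm]

theorem Integrable.mem_flowRegular_diag [T2Space N] {X : PolyvectorField s n N} (h : X.Integrable)
    (t : EuclideanSpace ℝ (Fin s)) (x : N) : (t, t, x) ∈ X.flowRegular := by
  set e := extChartAt (𝓡 n) x with he
  set A := X.chartField x with hA
  have hO : IsOpen ((univ : Set (EuclideanSpace ℝ (Fin s))) ×ˢ e.target) :=
    isOpen_univ.prod (isOpen_extChartAt_target x)
  have hpO : (t, e x) ∈ (univ : Set (EuclideanSpace ℝ (Fin s))) ×ˢ e.target :=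
    ⟨trivial, mem_extChartAt_target x⟩
  obtain ⟨B, hB, hBA⟩ := (X.contDiffOn_chartField x).exists_contDiff_eventuallyEq hO hpO
  obtain ⟨g, hg, hg0⟩ := exists_local_flow hB (t₁ := t) (y₁ := e x) (by
    filter_upwards [hBA.eventuallyEq_nhds, hO.mem_nhds hpO] with p hp hpO v w
    rw [hp.fderiv_eq, hp.self_of_nhds]
    exact h.chartField_symm hpO.2 v w)
  have hg1 : g (t, t, e x) = e x := hg0.self_of_nhds
  have hgc : ContinuousAt (fun q => (q.1, g q)) (t, t, e x) :=
    continuousAt_fst.prodMk hg.self_of_nhds.1.continuousAt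
  have hgood : ∀ᶠ q in 𝓝 (t, t, e x), ContDiffAt ℝ ∞ g q ∧ g q ∈ e.target ∧
      HasFDerivAt (fun t => g (t, q.2)) (A (q.1, g q)) q.1 := by
    have h1 := hgc.eventually (p := fun p => B p = A p) (by simpa only [hg1] using! hBA)
    have h2 := hgc.preimage_mem_nhds (hO.mem_nhds (by simpa only [hg1] using hpO))
    filter_upwards [hg, h1, h2] with q hq1 hq2 hq3
    exact ⟨hq1.1, hq3.2, by rw [← hq2]; exact hq1.2⟩
  rw [nhds_prod_eq, Filter.eventually_iff, mem_prod_iff] at hgood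
  obtain ⟨U, hU, W, hW, hUW⟩ := hgood
  -- A ball of times provides the convex domain that `Joins` demands, common to all nearby initial
  -- data.
  obtain ⟨r, hr, hrU⟩ := Metric.mem_nhds_iff.1 hU
  have hcoord : ContinuousAt (fun q : EuclideanSpace ℝ (Fin s) × EuclideanSpace ℝ (Fin s) × N =>
      (q.2.1, e q.2.2)) (t, t, x) := by
    have h1 : ContinuousAt (fun q : EuclideanSpace ℝ (Fin s) × EuclideanSpace ℝ (Fin s) × N =>
      e q.2.2) (t, t, x) :=
      ContinuousAt.comp (g := e) (continuousAt_extChartAt x) (by fun_prop)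
    exact ContinuousAt.prodMk (by fun_prop) h1
  have hball : Metric.ball t r ∈ 𝓝 t := Metric.ball_mem_nhds t hr
  have hev : ∀ᶠ q : EuclideanSpace ℝ (Fin s) × EuclideanSpace ℝ (Fin s) × N in 𝓝 (t, t, x),
      q.1 ∈ Metric.ball t r ∧ q.2.1 ∈ Metric.ball t r ∧ (q.2.1, e q.2.2) ∈ W ∧
        g (q.2.1, q.2.1, e q.2.2) = e q.2.2 ∧ q.2.2 ∈ e.source := by
    have c1 : ContinuousAt (fun q : EuclideanSpace ℝ (Fin s) × EuclideanSpace ℝ (Fin s) × N =>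
      q.1) (t, t, x) := by fun_prop
    have c2 : ContinuousAt (fun q : EuclideanSpace ℝ (Fin s) × EuclideanSpace ℝ (Fin s) × N =>
      q.2.1) (t, t, x) := by fun_prop
    have c3 : ContinuousAt (fun q : EuclideanSpace ℝ (Fin s) × EuclideanSpace ℝ (Fin s) × N =>
      q.2.2) (t, t, x) := by fun_prop
    exact (c1.eventually hball).and ((c2.eventually hball).and ((hcoord.eventually hW).and
      ((hcoord.eventually hg0).and (c3.eventually (extChartAt_source_mem_nhds x)))))
  have hjoin : ∀ᶠ q in 𝓝 (t, t, x),
      X.Joins q (fun t' => e.symm (g (t', q.2.1, e q.2.2))) := by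
    filter_upwards [hev] with q ⟨hq1, hq2, hq3, hq4, hq5⟩
    refine ⟨Metric.ball t r, Metric.isOpen_ball, convex_ball t r, hq1, hq2, ?_, ?_⟩
    · intro t' ht'
      obtain ⟨-, hd2, hd3⟩ := hUW (mk_mem_prod (hrU ht') hq3)
      have h1 := (hasMFDerivAt_extChartAt_symm hd2).comp t' hd3.hasMFDerivAt
      have h2 := X.mfderivWithin_comp_chartField (x₁ := x) (p := (t', g (t', q.2.1, e q.2.2))) hd2
      exact (congrArg (HasMFDerivAt (𝓡 s) (𝓡 n) (fun t' => e.symm (g (t', q.2.1, e q.2.2))) t')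
        h2).mp h1
    · exact (congrArg e.symm hq4).trans (e.left_inv hq5)
  change ∀ᶠ q in 𝓝 (t, t, x), _
  filter_upwards [hev, hjoin.eventually_nhds] with q ⟨hq1, hq2, hq3, hq4, hq5⟩ hq
  refine ⟨⟨_, hq.self_of_nhds⟩, ?_⟩
  have heq : X.flow =ᶠ[𝓝 q] fun q => e.symm (g (q.1, q.2.1, e q.2.2)) :=
    hq.mono fun q' hq' => hq'.flow_eq
  refine ContMDiffAt.congr_of_eventuallyEq ?_ heq
  obtain ⟨hd1, hd2, -⟩ := hUW (mk_mem_prod (hrU hq1) hq3)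
  have hsymm : ContMDiffAt (𝓡 n) (𝓡 n) ∞ e.symm (g (q.1, q.2.1, e q.2.2)) :=
    (contMDiffOn_extChartAt_symm x).contMDiffAt ((isOpen_extChartAt_target x).mem_nhds hd2)
  have hex : ContMDiffAt (𝓡 n) (𝓡 n) ∞ e q.2.2 :=
    contMDiffAt_extChartAt' (by rwa [← extChartAt_source (𝓡 n)])
  have hex' : ContMDiffAt ((𝓡 s).prod ((𝓡 s).prod (𝓡 n))) (𝓡 n) ∞
      (fun q : EuclideanSpace ℝ (Fin s) × EuclideanSpace ℝ (Fin s) × N => e q.2.2) q :=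
    ContMDiffAt.comp (g := e) q hex (contMDiffAt_snd.comp q contMDiffAt_snd)
  have hcoords : ContMDiffAt ((𝓡 s).prod ((𝓡 s).prod (𝓡 n)))
      𝓘(ℝ, EuclideanSpace ℝ (Fin s) × EuclideanSpace ℝ (Fin s) × EuclideanSpace ℝ (Fin n)) ∞
      (fun q : EuclideanSpace ℝ (Fin s) × EuclideanSpace ℝ (Fin s) × N =>
        (q.1, q.2.1, e q.2.2)) q :=
    contMDiffAt_fst.prodMk_space ((contMDiffAt_fst.comp q contMDiffAt_snd).prodMk_space hex')
  exact ContMDiffAt.comp (g := e.symm) q hsymm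
    (ContMDiffAt.comp (g := g) q hd1.contMDiffAt hcoords)

/-! ### Straightening and the bundle isomorphism -/

theorem contMDiffAt_straighten {X : PolyvectorField s n N} {t₀ : EuclideanSpace ℝ (Fin s)}
    {p : EuclideanSpace ℝ (Fin s) × N} (h : (p.1, t₀, p.2) ∈ X.flowRegular) :
    ContMDiffAt ((𝓡 s).prod (𝓡 n)) ((𝓡 s).prod (𝓡 n)) ∞
      (fun p : EuclideanSpace ℝ (Fin s) × N => (p.1, X.flow (p.1, t₀, p.2))) p :=
  contMDiffAt_fst.prodMk (ContMDiffAt.comp (g := X.flow) p (contMDiffAt_flow h)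
    (contMDiffAt_fst.prodMk (contMDiffAt_const.prodMk contMDiffAt_snd)))

theorem contMDiffAt_straighten_symm {X : PolyvectorField s n N} {t₀ : EuclideanSpace ℝ (Fin s)}
    {p : EuclideanSpace ℝ (Fin s) × N} (h : (t₀, p) ∈ X.flowRegular) :
    ContMDiffAt ((𝓡 s).prod (𝓡 n)) ((𝓡 s).prod (𝓡 n)) ∞
      (fun p : EuclideanSpace ℝ (Fin s) × N => (p.1, X.flow (t₀, p))) p :=
  contMDiffAt_fst.prodMk (ContMDiffAt.comp (g := X.flow) p (contMDiffAt_flow h)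
    (contMDiffAt_const.prodMk contMDiffAt_id))

theorem isOpen_straighten_source (X : PolyvectorField s n N) (t₀ : EuclideanSpace ℝ (Fin s)) :
    IsOpen {p : EuclideanSpace ℝ (Fin s) × N | (p.1, t₀, p.2) ∈ X.flowRegular ∧
      (t₀, p.1, X.flow (p.1, t₀, p.2)) ∈ X.flowRegular} := by
  have ho : IsOpen {p : EuclideanSpace ℝ (Fin s) × N | (p.1, t₀, p.2) ∈ X.flowRegular} :=
    X.isOpen_flowRegular.preimage (by fun_prop)
  refine ContinuousOn.isOpen_inter_preimage (s := {p | (p.1, t₀, p.2) ∈ X.flowRegular})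
    (f := fun p : EuclideanSpace ℝ (Fin s) × N => (t₀, p.1, X.flow (p.1, t₀, p.2))) ?_ ho
    X.isOpen_flowRegular
  exact fun p hp =>
    (continuousAt_const.prodMk (contMDiffAt_straighten hp).continuousAt).continuousWithinAt

theorem isOpen_straighten_target (X : PolyvectorField s n N) (t₀ : EuclideanSpace ℝ (Fin s)) :
    IsOpen {p : EuclideanSpace ℝ (Fin s) × N | (t₀, p) ∈ X.flowRegular ∧
      (p.1, t₀, X.flow (t₀, p)) ∈ X.flowRegular} := by
  have ho : IsOpen {p : EuclideanSpace ℝ (Fin s) × N | (t₀, p) ∈ X.flowRegular} :=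
    X.isOpen_flowRegular.preimage (by fun_prop)
  refine ContinuousOn.isOpen_inter_preimage (s := {p | (t₀, p) ∈ X.flowRegular})
    (f := fun p : EuclideanSpace ℝ (Fin s) × N => (p.1, t₀, X.flow (t₀, p))) ?_ ho
    X.isOpen_flowRegular
  intro p hp
  have := continuousAt_snd.comp (contMDiffAt_straighten_symm hp).continuousAt
  exact (continuousAt_fst.prodMk (continuousAt_const.prodMk this)).continuousWithinAt

/-- The bundle isomorphism `(t, x) ↦ (t, flow (t, t₀, x))`, which maps the trivial system onto the
system given by `X`. -/
noncomputable def straighten [T2Space N] (X : PolyvectorField s n N)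
    (t₀ : EuclideanSpace ℝ (Fin s)) :
    OpenPartialHomeomorph (EuclideanSpace ℝ (Fin s) × N) (EuclideanSpace ℝ (Fin s) × N) where
  toFun p := (p.1, X.flow (p.1, t₀, p.2))
  invFun p := (p.1, X.flow (t₀, p))
  source := {p | (p.1, t₀, p.2) ∈ X.flowRegular ∧
    (t₀, p.1, X.flow (p.1, t₀, p.2)) ∈ X.flowRegular}
  target := {p | (t₀, p) ∈ X.flowRegular ∧ (p.1, t₀, X.flow (t₀, p)) ∈ X.flowRegular}
  map_source' p hp := ⟨hp.2, by
    simpa only [flow_flow (mem_flowDomain_of_mem_flowRegular hp.1)] using hp.1⟩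
  map_target' p hp := ⟨hp.2, by
    have := flow_flow (t := t₀) (t₀ := p.1) (x := p.2) (mem_flowDomain_of_mem_flowRegular hp.1)
    simpa only [this] using hp.1⟩
  left_inv' p hp := Prod.ext rfl (flow_flow (mem_flowDomain_of_mem_flowRegular hp.1))
  right_inv' p hp := Prod.ext rfl (flow_flow (t := t₀) (t₀ := p.1) (x := p.2)
    (mem_flowDomain_of_mem_flowRegular hp.1))
  open_source := X.isOpen_straighten_source t₀
  open_target := X.isOpen_straighten_target t₀
  continuousOn_toFun p hp := (contMDiffAt_straighten hp.1).continuousAt.continuousWithinAt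
  continuousOn_invFun p hp := (contMDiffAt_straighten_symm hp.1).continuousAt.continuousWithinAt

/-- The graph of the solution through `(t₀, z)` has the derivative `∂_π + X_π`. -/
theorem hasMFDerivAt_graph [T2Space N] {X : PolyvectorField s n N}
    {t t₀ : EuclideanSpace ℝ (Fin s)} {z : N} (h : (t, t₀, z) ∈ X.flowDomain) :
    HasMFDerivAt (𝓡 s) ((𝓡 s).prod (𝓡 n)) (fun t => (t, X.flow (t, t₀, z))) t
      ((ContinuousLinearMap.id ℝ (TangentSpace (𝓡 s) t)).prod
        (X.total t (X.flow (t, t₀, z)))) :=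
  (hasMFDerivAt_id t).prodMk (hasMFDerivAt_flow h)

/-- The composite sends the graph of the `X₁`-solution through `(t₀, z)` to the graph of the
`X₂`-solution through the same point. The chain rule at `t`, in the direction `e_π`, then gives the
relation. -/
theorem bundleRelated_straighten [T2Space N] (X₁ X₂ : PolyvectorField s n N)
    (t₀ : EuclideanSpace ℝ (Fin s)) :
    X₁.BundleRelated X₂ ((X₁.straighten t₀).symm.trans (X₂.straighten t₀)) where
  smooth := by
    rintro p ⟨hp1, hp2⟩
    refine ContMDiffAt.contMDiffWithinAt ?_
    exact ContMDiffAt.comp (g := X₂.straighten t₀) p (contMDiffAt_straighten hp2.1)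
      (contMDiffAt_straighten_symm hp1.1)
  smooth_symm := by
    rintro p ⟨hp1, hp2⟩
    refine ContMDiffAt.contMDiffWithinAt ?_
    exact ContMDiffAt.comp (g := X₁.straighten t₀) p (contMDiffAt_straighten hp2.1)
      (contMDiffAt_straighten_symm hp1.1)
  fst_eq := fun p hp => rfl
  map_autonomised := by
    intro p hp π
    obtain ⟨hp1, hp2⟩ := hp
    set φ := (X₁.straighten t₀).symm.trans (X₂.straighten t₀) with hφ
    have hsm : MDifferentiableAt ((𝓡 s).prod (𝓡 n)) ((𝓡 s).prod (𝓡 n)) φ p :=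
      (ContMDiffAt.comp p (contMDiffAt_straighten hp2.1)
        (contMDiffAt_straighten_symm hp1.1)).mdifferentiableAt (by simp)
    obtain ⟨t, x⟩ := p
    set z := X₁.flow (t₀, t, x) with hz
    have hz1 : (t, t₀, z) ∈ X₁.flowRegular := hp1.2
    have hz2 : (t, t₀, z) ∈ X₂.flowRegular := hp2.1
    have hx : X₁.flow (t, t₀, z) = x :=
      flow_flow (t := t₀) (t₀ := t) (x := x) (mem_flowDomain_of_mem_flowRegular hp1.1)
    have h1 := hasMFDerivAt_graph (mem_flowDomain_of_mem_flowRegular hz1)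
    have h2 := hasMFDerivAt_graph (mem_flowDomain_of_mem_flowRegular hz2)
    have hopen : IsOpen {t' : EuclideanSpace ℝ (Fin s) | (t', t₀, z) ∈ X₁.flowRegular} :=
      X₁.isOpen_flowRegular.preimage (by fun_prop)
    have heq : (fun t' => φ (t', X₁.flow (t', t₀, z))) =ᶠ[𝓝 t]
        fun t' => (t', X₂.flow (t', t₀, z)) := by
      filter_upwards [hopen.mem_nhds hz1] with t' ht'
      refine Prod.ext rfl ?_
      change X₂.flow (t', t₀, X₁.flow (t₀, t', X₁.flow (t', t₀, z))) = X₂.flow (t', t₀, z)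
      rw [flow_flow (mem_flowDomain_of_mem_flowRegular ht')]
    have hsm' : HasMFDerivAt ((𝓡 s).prod (𝓡 n)) ((𝓡 s).prod (𝓡 n)) φ (t, X₁.flow (t, t₀, z))
      (mfderiv ((𝓡 s).prod (𝓡 n)) ((𝓡 s).prod (𝓡 n)) φ (t, X₁.flow (t, t₀, z))) := by
      rw [hx]
      exact hsm.hasMFDerivAt
    have h3 := HasMFDerivAt.comp (g := φ) t hsm' h1
    have h4 := hasMFDerivAt_unique (h3.congr_of_eventuallyEq heq.symm) h2
    have h5 := DFunLike.congr_fun h4 (EuclideanSpace.single π (1 : ℝ))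
    have h6 : mfderiv ((𝓡 s).prod (𝓡 n)) ((𝓡 s).prod (𝓡 n)) φ (t, X₁.flow (t, t₀, z))
        (X₁.autonomised π (t, X₁.flow (t, t₀, z))) =
        X₂.autonomised π (t, X₂.flow (t, t₀, z)) := by
      have e1 := X₁.total_single t (X₁.flow (t, t₀, z)) π
      have e2 := X₂.total_single t (X₂.flow (t, t₀, z)) π
      unfold autonomised
      dsimp only
      rw [← e1, ← e2]
      exact h5
    rw [hx] at h6
    exact h6

/-- At `t = t₀` no time elapses, so the straightening fixes the fibre pointwise, and regularity on
the diagonal places the fibre in source and target. -/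
theorem fibre_subset_straighten [T2Space N] {X : PolyvectorField s n N} (h : X.Integrable)
    {t₀ : EuclideanSpace ℝ (Fin s)} {p : EuclideanSpace ℝ (Fin s) × N} (hp : p.1 = t₀) :
    p ∈ (X.straighten t₀).source ∧ p ∈ (X.straighten t₀).target ∧ X.straighten t₀ p = p ∧
      (X.straighten t₀).symm p = p := by
  obtain ⟨t, x⟩ := p
  obtain rfl : t = t₀ := hp
  have h1 := h.mem_flowRegular_diag t x
  have h2 := flow_self (mem_flowDomain_of_mem_flowRegular h1)
  refine ⟨⟨h1, ?_⟩, ⟨h1, ?_⟩, Prod.ext rfl h2, Prod.ext rfl h2⟩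
  · simpa only [h2] using h1
  · simpa only [h2] using h1

end PolyvectorField

theorem proposition2p1 (s n : ℕ) (N : Type*) [TopologicalSpace N] [T2Space N]
    [ChartedSpace (EuclideanSpace ℝ (Fin n)) N] [IsManifold (𝓡 n) ∞ N]
    (X₁ X₂ : PolyvectorField s n N) (h₁ : X₁.Integrable) (h₂ : X₂.Integrable) :
    -- globally: a bundle isomorphism of `ℝ^s × N`
    (X₁.HasGlobalSolutions → X₂.HasGlobalSolutions →
      ∃ φ : OpenPartialHomeomorph (EuclideanSpace ℝ (Fin s) × N) (EuclideanSpace ℝ (Fin s) × N),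
        φ.source = univ ∧ φ.target = univ ∧ X₁.BundleRelated X₂ φ) ∧
    -- locally, around every fibre, without assuming that solutions are global
    (∀ t₀ : EuclideanSpace ℝ (Fin s),
      ∃ φ : OpenPartialHomeomorph (EuclideanSpace ℝ (Fin s) × N) (EuclideanSpace ℝ (Fin s) × N),
        {p | p.1 = t₀} ⊆ φ.source ∧ {p | p.1 = t₀} ⊆ φ.target ∧ X₁.BundleRelated X₂ φ) := by
  constructor
  · intro g₁ g₂
    have e₁ := g₁.flowRegular_eq h₁.mem_flowRegular_diag
    have e₂ := g₂.flowRegular_eq h₂.mem_flowRegular_diag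
    -- Any base time would serve; all domains are the whole space.
    refine ⟨_, ?_, ?_, PolyvectorField.bundleRelated_straighten X₁ X₂ 0⟩ <;>
      simp [PolyvectorField.straighten, e₁, e₂]
  · intro t₀
    refine ⟨_, ?_, ?_, PolyvectorField.bundleRelated_straighten X₁ X₂ t₀⟩
    · intro p hp
      have f₁ := PolyvectorField.fibre_subset_straighten h₁ hp
      have f₂ := PolyvectorField.fibre_subset_straighten h₂ hp
      refine ⟨f₁.2.1, ?_⟩
      change (X₁.straighten t₀).symm p ∈ (X₂.straighten t₀).source
      rw [f₁.2.2.2]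
      exact f₂.1
    · intro p hp
      have f₁ := PolyvectorField.fibre_subset_straighten h₁ hp
      have f₂ := PolyvectorField.fibre_subset_straighten h₂ hp
      refine ⟨f₂.2.1, ?_⟩
      change (X₂.straighten t₀).symm p ∈ (X₁.straighten t₀).source
      rw [f₂.2.2.2]
      exact f₁.1
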